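/- Let $n\ge 2$ and let $k,\alpha,\beta\in\mathbb N$ with $k=\alpha+\beta$. Write $(z,w)=(z_1,\dots,z_n,w_1,\dots,w_n)$ for the coordinates of $\mathbb C^{2n}$ and let $\mathcal H^{\alpha,\beta}$ be the space of complex polynomials $P$ in $z,w,\bar z,\bar w$ that are homogeneous of degree $\alpha$ in $(z,w)$, homogeneous of degree $\beta$ in $(\bar z,\bar w)$, and harmonic: $\sum_{r=1}^n\big(\frac{\partial^2P}{\partial z_r\partial\bar z_r}+\frac{\partial^2P}{\partial w_r\partial\bar w_r}\big)=0$. Let $Sp(n)$ be the group of unitary symplectic $2n\times 2n$ matrices, that is, of the unitary matrices of the form $\begin{pmatrix}A&-\bar B\\ B&\bar A\end{pmatrix}$, acting by $L(u)P(v)=P(u^{-1}v)$ for $v=(z,w)\in\mathbb C^{2n}$; let $dL$ be the infinitesimal action, extended complex-linearly to $$\mathfrak g=\mathfrak{sp}(n,\mathbb C)=\left\{\begin{pmatrix}A&C\\ B&-{}^tA\end{pmatrix}: B,C\text{ symmetric}\right\}.$$ Let $\mathfrak h\subset\mathfrak g$ be the subalgebra of diagonal matrices, let $L_r\in\mathfrak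 h^*$ be the $r$-th diagonal entry ($1\le r\le n$), and take $L_r-L_s$, $L_r+L_s$ ($r<s$) and $2L_r$ as positive roots. A nonzero polynomial $P$ is a highest weight vector of weight $\sigma\in\mathfrak h^*$ if $dL(H)P=\sigma(H)P$ for all $H\in\mathfrak h$ and $dL(X)P=0$ for every $X$ in a positive root space. Then $\mathcal H^{\alpha,\beta}$ is invariant under $L$, and for every integer $\gamma$ with $0\le\gamma\le\min(\alpha,\beta)$ the polynomial $$P_\gamma^{\alpha,\beta}=w_1^{\alpha-\gamma}\,\bar z_1^{\,\beta-\gamma}\,(w_2\bar z_1-w_1\bar z_2)^\gamma$$ belongs to $\mathcal H^{\alpha,\beta}$ and is a highest weight vector of weight $(k-\gamma)L_1+\gamma L_2=(k-\gamma,\gamma,0,\dots,0)$. The invariant subspace $V_\gamma^{\alpha,\beta}$ that $P_\gamma^{\alpha,\beta}$ generates under $Sp(n)$ is contained in $\mathcal H^{\alpha,\beta}$, is irreducible, and has dimension $$\dim_{\mathbb C} V_\gamma^{\alpha,\beta}=\frac{(k-\gamma+2n-2)!\,(\gamma+2n-3)!\,(k-2\gamma+1)\,(k+2n-1)}{(k-\gamma+1)!\,\gamma!\,(2n-1)!\,(2n-3)!}.$$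 Moreover $$\mathcal H^{\alpha,\beta}=\bigoplus_{\gamma=0}^{\min(\alpha,\beta)}V_\gamma^{\alpha,\beta}.$$ -/

import Mathlib

namespace SpHarm

open MvPolynomial Matrix

/-- Indices of the coordinates of `ℂ^{2n}`: `inl r` stands for `z_r`, `inr r` for `w_r`. -/
abbrev Idx (n : ℕ) : Type := Fin n ⊕ Fin n

/-- Complex polynomials in the variables `(z, w)` (first copy of `Idx n`) and their conjugates
`(z̄, w̄)` (second copy of `Idx n`). -/
abbrev Poly (n : ℕ) : Type := MvPolynomial (Idx n ⊕ Idx n) ℂ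

/-- The variables `(z, w)`. -/
noncomputable def hol {n : ℕ} (i : Idx n) : Poly n := X (Sum.inl i)

/-- The variables `(z̄, w̄)`. -/
noncomputable def conj {n : ℕ} (i : Idx n) : Poly n := X (Sum.inr i)

/-- The value of a polynomial as a function of the point `v = (z, w)` of `ℂ^{2n}`. -/
noncomputable def value {n : ℕ} (v : Idx n → ℂ) (P : Poly n) : ℂ :=
  eval (Sum.elim v (star v)) P

/-- `Sp(n)`: the unitary `2n × 2n` matrices that are symplectic. -/
def Sp (n : ℕ) : Subgroup (Matrix.unitaryGroup (Idx n) ℂ) where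
  carrier := {u | (u : Matrix (Idx n) (Idx n) ℂ) ∈ Matrix.symplecticGroup (Fin n) ℂ}
  mul_mem' := fun {a b} ha hb => (Matrix.symplecticGroup (Fin n) ℂ).mul_mem ha hb
  one_mem' := (Matrix.symplecticGroup (Fin n) ℂ).one_mem
  inv_mem' := by
    intro u hu
    have h2 : ((u⁻¹ : Matrix.unitaryGroup (Idx n) ℂ) : Matrix (Idx n) (Idx n) ℂ)
        = ((⟨_, hu⟩ : Matrix.symplecticGroup (Fin n) ℂ)⁻¹ :
          Matrix.symplecticGroup (Fin n) ℂ) := by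
      rw [SymplecticGroup.coe_inv']
      symm
      apply Matrix.inv_eq_right_inv
      exact congrArg Subtype.val (mul_inv_cancel u)
    change ((u⁻¹ : Matrix.unitaryGroup (Idx n) ℂ) : Matrix (Idx n) (Idx n) ℂ) ∈
      Matrix.symplecticGroup (Fin n) ℂ
    rw [h2]
    exact Subtype.property _

/-- The matrix of an element of `Sp(n)`. -/
def Sp.mat {n : ℕ} (u : Sp n) : Matrix (Idx n) (Idx n) ℂ := u.1.1

/-- The substitution `P(z, z̄) ↦ P(A z, B z̄)`. -/
noncomputable def subst {n : ℕ} (A B : Matrix (Idx n) (Idx n) ℂ) : Poly n →ₐ[ℂ] Poly n :=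
  aeval (Sum.elim (fun i => ∑ j, C (A i j) * hol j) (fun i => ∑ j, C (B i j) * conj j))

theorem subst_one {n : ℕ} : subst (1 : Matrix (Idx n) (Idx n) ℂ) 1 = AlgHom.id ℂ _ := by
  apply MvPolynomial.algHom_ext
  rintro (i | i) <;> simp [subst, hol, conj, Matrix.one_apply, apply_ite C]

theorem subst_subst {n : ℕ} (A B A' B' : Matrix (Idx n) (Idx n) ℂ) (P : Poly n) :
    subst A B (subst A' B' P) = subst (A' * A) (B' * B) P := by
  have : (subst A B).comp (subst A' B') = subst (A' * A) (B' * B) := by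
    apply MvPolynomial.algHom_ext
    rintro (i | i)
    all_goals
      simp only [subst, hol, conj, AlgHom.comp_apply, aeval_X, Sum.elim_inl, Sum.elim_inr,
        map_sum, map_mul, algHom_C, algebraMap_eq, Matrix.mul_apply, Finset.mul_sum,
        Finset.sum_mul, mul_assoc]
      exact Finset.sum_comm
  exact DFunLike.congr_fun this P

/-- The left action `L(u) P (z, z̄) = P(u⁻¹ z, ᵗu z̄)` of `Sp(n)` on polynomials. -/
noncomputable def leftAction (n : ℕ) : Representation ℂ (Sp n) (Poly n) where
  toFun u := (subst (Sp.mat u⁻¹) (Sp.mat u)ᵀ).toLinearMap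
  map_one' := by
    ext1 P
    have h : subst (Sp.mat (1 : Sp n)) (Sp.mat (1 : Sp n))ᵀ = AlgHom.id ℂ _ := by
      have h1 : Sp.mat (1 : Sp n) = 1 := rfl
      rw [h1, Matrix.transpose_one, subst_one]
    simp only [inv_one, h]
    rfl
  map_mul' u v := by
    apply LinearMap.ext
    intro P
    change subst _ _ P = subst _ _ (subst _ _ P)
    rw [subst_subst, _root_.mul_inv_rev]
    have h1 : Sp.mat (v⁻¹ * u⁻¹) = Sp.mat v⁻¹ * Sp.mat u⁻¹ := rfl
    have h2 : Sp.mat (u * v) = Sp.mat u * Sp.mat v := rfl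
    rw [h1, h2, Matrix.transpose_mul]

theorem value_leftAction {n : ℕ} (u : Sp n) (P : Poly n) (v : Idx n → ℂ) :
    value v (leftAction n u P) = value (Sp.mat u⁻¹ *ᵥ v) P := by
  have hc : star (Sp.mat u⁻¹ *ᵥ v) = (Sp.mat u)ᵀ *ᵥ star v := by
    have h1 : Sp.mat u⁻¹ = (Sp.mat u)ᴴ := rfl
    rw [Matrix.star_mulVec, h1, Matrix.conjTranspose_conjTranspose, Matrix.mulVec_transpose]
  have h : (aeval (Sum.elim v (star v)) : Poly n →ₐ[ℂ] ℂ).comp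
      (subst (Sp.mat u⁻¹) (Sp.mat u)ᵀ)
      = aeval (Sum.elim (Sp.mat u⁻¹ *ᵥ v) (star (Sp.mat u⁻¹ *ᵥ v))) := by
    rw [hc]
    apply MvPolynomial.algHom_ext
    rintro (i | i) <;> simp [subst, hol, conj, Matrix.mulVec, dotProduct]
  exact DFunLike.congr_fun h P

/-- A polynomial in `(z, w, z̄, w̄)` is determined by the function it defines on `ℂ^{2n}`. -/
theorem value_injective {n : ℕ} (P Q : Poly n) (h : ∀ v, value v P = value v Q) : P = Q := by
  let f : Poly n →ₐ[ℂ] Poly n := aeval (Sum.elim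
    (fun i => hol i + C Complex.I * conj i) (fun i => hol i - C Complex.I * conj i))
  let g : Poly n →ₐ[ℂ] Poly n := aeval (Sum.elim
    (fun i => C (1 / 2) * (hol i + conj i))
    (fun i => C (-Complex.I / 2) * (hol i - conj i)))
  have hgf : g.comp f = AlgHom.id ℂ _ := by
    have e1 : (C Complex.I * C (-Complex.I / 2) : Poly n) = C (1 / 2) := by
      rw [← C_mul]
      congr 1
      linear_combination (-1 / 2 : ℂ) * Complex.I_mul_I
    have e2 : (C (1 / 2) + C (1 / 2) : Poly n) = 1 := by
      rw [← C_add, ← C_1]; norm_num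
    apply MvPolynomial.algHom_ext
    rintro (i | i)
    · simp only [f, g, hol, conj, AlgHom.comp_apply, aeval_X, Sum.elim_inl, Sum.elim_inr, map_add,
        map_mul, algHom_C, algebraMap_eq, ← mul_assoc, e1, AlgHom.id_apply]
      linear_combination (X (Sum.inl i) : Poly n) * e2
    · simp only [f, g, hol, conj, AlgHom.comp_apply, aeval_X, Sum.elim_inl, Sum.elim_inr, map_sub,
        map_mul, algHom_C, algebraMap_eq, ← mul_assoc, e1, AlgHom.id_apply]
      linear_combination (X (Sum.inr i) : Poly n) * e2
  have key : f P = f Q := by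
    apply MvPolynomial.funext_set (fun _ => Set.range ((↑) : ℝ → ℂ))
      (fun _ => Set.infinite_range_of_injective Complex.ofReal_injective)
    intro x hx
    have hx' : ∀ i, ∃ r : ℝ, (r : ℂ) = x i := fun i => hx i (Set.mem_univ i)
    have hs : ∀ i, star (x i) = x i := by
      intro i
      obtain ⟨r, hr⟩ := hx' i
      rw [← hr]; exact Complex.conj_ofReal r
    have hcomp : (aeval x : Poly n →ₐ[ℂ] ℂ).comp f = aeval (Sum.elim
        (fun i => x (Sum.inl i) + Complex.I * x (Sum.inr i))
        (star fun i => x (Sum.inl i) + Complex.I * x (Sum.inr i))) := by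
      apply MvPolynomial.algHom_ext
      rintro (i | i)
      · simp [f, hol, conj]
      · have h1 := hs (Sum.inl i)
        have h2 := hs (Sum.inr i)
        simp only [Complex.star_def] at h1 h2
        simp [f, hol, conj, h1, h2, sub_eq_add_neg]
    have hP := DFunLike.congr_fun hcomp P
    have hQ := DFunLike.congr_fun hcomp Q
    exact hP.trans ((h _).trans hQ.symm)
  have h1 := DFunLike.congr_fun hgf P
  have h2 := DFunLike.congr_fun hgf Q
  simp only [AlgHom.comp_apply, AlgHom.id_apply] at h1 h2
  rw [← h1, ← h2, key]

/-- The Laplace operator `4 ∑ ∂²/∂z_i ∂z̄_i`, the sum being over all `2n` coordinates. -/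
noncomputable def laplacian (n : ℕ) : Poly n →ₗ[ℂ] Poly n :=
  (4 : ℂ) • ∑ i : Idx n,
    (pderiv (Sum.inl i)).toLinearMap ∘ₗ (pderiv (Sum.inr i)).toLinearMap

/-- Degree of the variables with respect to `(z, w)`. -/
def holWeight (n : ℕ) : Idx n ⊕ Idx n → ℕ := Sum.elim (fun _ => 1) (fun _ => 0)

/-- Degree of the variables with respect to `(z̄, w̄)`. -/
def conjWeight (n : ℕ) : Idx n ⊕ Idx n → ℕ := Sum.elim (fun _ => 0) (fun _ => 1)

/-- The space of harmonic polynomials, homogeneous of degree `α` in `(z, w)` and of degree `β`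
in `(z̄, w̄)`. -/
noncomputable def harmonic (n α β : ℕ) : Submodule ℂ (Poly n) :=
  weightedHomogeneousSubmodule ℂ (holWeight n) α ⊓
    weightedHomogeneousSubmodule ℂ (conjWeight n) β ⊓ LinearMap.ker (laplacian n)

/-- The infinitesimal action: `dL(X) P = ∂P/∂z · (-X z) + ∂P/∂z̄ · (ᵗX z̄)`. -/
noncomputable def dL {n : ℕ} (Y : Matrix (Idx n) (Idx n) ℂ) (P : Poly n) : Poly n :=
  ∑ i, pderiv (Sum.inl i) P * (-∑ j, C (Y i j) * hol j)
    + ∑ i, pderiv (Sum.inr i) P * ∑ j, C (Yᵀ i j) * conj j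

/-- `dL` is the derivative of the left action along one-parameter subgroups of `Sp(n)`. -/
theorem hasDerivAt_value_exp {n : ℕ} (Y : Matrix (Idx n) (Idx n) ℂ) (hY : Yᴴ = -Y) (P : Poly n)
    (v : Idx n → ℂ) :
    HasDerivAt (fun t : ℝ => value (NormedSpace.exp (-t • Y) *ᵥ v) P) (value v (dL Y P)) 0 := by
  let _ : NormedRing (Matrix (Idx n) (Idx n) ℂ) := Matrix.linftyOpNormedRing
  let _ : NormedAlgebra ℝ (Matrix (Idx n) (Idx n) ℂ) := Matrix.linftyOpNormedAlgebra
  have hexp : HasDerivAt (fun t : ℝ => NormedSpace.exp (t • (-Y))) (-Y) 0 := by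
    have := hasDerivAt_exp_smul_const (𝕂 := ℝ) (-Y) (0 : ℝ)
    rw [zero_smul, NormedSpace.exp_zero, one_mul] at this
    exact this
  have hz : ∀ i, HasDerivAt (fun t : ℝ => (NormedSpace.exp (-t • Y) *ᵥ v) i)
      (((-Y) *ᵥ v) i) 0 := by
    intro i
    let f : Matrix (Idx n) (Idx n) ℂ →ₗ[ℝ] ℂ :=
      { toFun := fun M => (M *ᵥ v) i
        map_add' := fun M N => by simp [Matrix.add_mulVec]
        map_smul' := fun c M => by simp [Matrix.smul_mulVec] }
    have := (LinearMap.toContinuousLinearMap f).hasFDerivAt.comp_hasDerivAt (0 : ℝ) hexp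
    refine this.congr_of_eventuallyEq (Filter.Eventually.of_forall fun t => ?_)
    simp [f]
  have hw : ∀ i, HasDerivAt (fun t : ℝ => star ((NormedSpace.exp (-t • Y) *ᵥ v) i))
      ((Yᵀ *ᵥ star v) i) 0 := by
    intro i
    have := (hz i).star
    have h1 : star ((-Y) *ᵥ v) = Yᵀ *ᵥ star v := by
      rw [Matrix.star_mulVec, ← hY, Matrix.conjTranspose_conjTranspose, Matrix.mulVec_transpose]
    rw [← h1]
    exact this
  have h0 : NormedSpace.exp (-(0 : ℝ) • Y) *ᵥ v = v := by simp
  induction P using MvPolynomial.induction_on with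
  | C a => simpa [value, dL] using hasDerivAt_const (0 : ℝ) a
  | add p q hp hq =>
    have h1 : dL Y (p + q) = dL Y p + dL Y q := by
      simp only [dL, map_add, add_mul, Finset.sum_add_distrib]; ring
    rw [h1]
    simp only [value, map_add]
    exact hp.add hq
  | mul_X p i hp =>
    have hx : HasDerivAt (fun t : ℝ => value (NormedSpace.exp (-t • Y) *ᵥ v) (X i))
        (value v (dL Y (X i))) 0 := by
      rcases i with i | i
      · simpa [value, dL, hol, conj, pderiv_X, Pi.single_apply, Matrix.mulVec, dotProduct]
          using hz i
      · simpa [value, dL, hol, conj, pderiv_X, Pi.single_apply, Matrix.mulVec, dotProduct]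
          using hw i
    have h1 : dL Y (p * X i) = dL Y p * X i + p * dL Y (X i) := by
      simp only [dL, Derivation.leibniz, smul_eq_mul, add_mul, mul_add, Finset.sum_add_distrib,
        Finset.sum_mul, Finset.mul_sum]
      simp only [mul_assoc, mul_comm, mul_left_comm]
      ring
    have := hp.mul hx
    rw [h1]
    simp only [value, map_mul, map_add] at this ⊢
    rw [← value, h0] at this
    exact this

/-- Membership in the Lie algebra `sp(n, ℂ)`. -/
def IsSymplecticLie {n : ℕ} (Y : Matrix (Idx n) (Idx n) ℂ) : Prop :=
  ∃ A B C : Matrix (Fin n) (Fin n) ℂ, B.IsSymm ∧ C.IsSymm ∧ Y = Matrix.fromBlocks A C B (-Aᵀ)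

/-- The Cartan subalgebra of the diagonal elements of `sp(n, ℂ)`. -/
def cartan (n : ℕ) : Submodule ℂ (Matrix (Idx n) (Idx n) ℂ) where
  carrier := {H | IsSymplecticLie H ∧ H.IsDiag}
  add_mem' := by
    rintro _ _ ⟨⟨A, B, C, hB, hC, rfl⟩, h⟩ ⟨⟨A', B', C', hB', hC', rfl⟩, h'⟩
    refine ⟨⟨A + A', B + B', C + C', hB.add hB', hC.add hC', ?_⟩, h.add h'⟩
    rw [Matrix.fromBlocks_add, Matrix.transpose_add, neg_add]
  zero_mem' := ⟨⟨0, 0, 0, Matrix.isSymm_zero, Matrix.isSymm_zero, by simp⟩, Matrix.isDiag_zero⟩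
  smul_mem' := by
    rintro c _ ⟨⟨A, B, C, hB, hC, rfl⟩, h⟩
    refine ⟨⟨c • A, c • B, c • C, hB.smul c, hC.smul c, ?_⟩, h.smul c⟩
    rw [Matrix.fromBlocks_smul, Matrix.transpose_smul, smul_neg]

/-- The linear form `L_r` on the Cartan subalgebra: the `r`-th diagonal coefficient. -/
def L {n : ℕ} (r : Fin n) : Module.Dual ℂ (cartan n) where
  toFun H := H.1 (Sum.inl r) (Sum.inl r)
  map_add' _ _ := rfl
  map_smul' _ _ := rfl

/-- Elementary matrices. -/
def E {n : ℕ} (i j : Idx n) : Matrix (Idx n) (Idx n) ℂ := Matrix.single i j 1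

/-- Generators of the root spaces for the positive roots `L_r - L_s`, `L_r + L_s` (`r < s`) and
`2 L_r`. -/
inductive IsPositiveRootVector {n : ℕ} : Matrix (Idx n) (Idx n) ℂ → Prop
  | sub (r s : Fin n) (h : r < s) :
      IsPositiveRootVector (E (.inl r) (.inl s) - E (.inr s) (.inr r))
  | add (r s : Fin n) (h : r < s) :
      IsPositiveRootVector (E (.inl r) (.inr s) + E (.inl s) (.inr r))
  | two (r : Fin n) : IsPositiveRootVector (E (.inl r) (.inr r))

/-- `P` is a highest weight vector, with weight `σ`, for the left action of `Sp(n)`. -/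
structure IsHighestWeightVector {n : ℕ} (σ : Module.Dual ℂ (cartan n)) (P : Poly n) : Prop where
  ne_zero : P ≠ 0
  weight : ∀ H : cartan n, dL H.1 P = σ H • P
  annihilated : ∀ Y : Matrix (Idx n) (Idx n) ℂ, IsPositiveRootVector Y → dL Y P = 0

/-- The polynomial `w₁^{α-γ} z̄₁^{β-γ} (w₂ z̄₁ - w₁ z̄₂)^γ` (used for `γ ≤ min α β`). -/
noncomputable def hwPoly {n : ℕ} (hn : 2 ≤ n) (α β γ : ℕ) : Poly n :=
  let one : Fin n := ⟨0, by omega⟩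
  let two : Fin n := ⟨1, by omega⟩
  hol (.inr one) ^ (α - γ) * conj (.inl one) ^ (β - γ) *
    (hol (.inr two) * conj (.inl one) - hol (.inr one) * conj (.inl two)) ^ γ

/-- The smallest subspace containing `P` that is invariant under the left action of `Sp(n)`. -/
noncomputable def generated {n : ℕ} (P : Poly n) : Subrepresentation (leftAction n) where
  toSubmodule := Submodule.span ℂ (Set.range fun u : Sp n => leftAction n u P)
  apply_mem_toSubmodule := by
    intro g v hv
    induction hv using Submodule.span_induction with
    | mem x hx =>
      obtain ⟨u, rfl⟩ := hx
      refine Submodule.subset_span ⟨g * u, ?_⟩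
      simp only [map_mul]
      rfl
    | zero => simp
    | add x y _ _ hx hy => rw [map_add]; exact add_mem hx hy
    | smul c x _ hx => rw [map_smul]; exact Submodule.smul_mem _ c hx

/-- The component `V_γ^{α,β}`: the invariant subspace generated by the highest weight vector
`P_γ^{α,β}`. -/
noncomputable def V {n : ℕ} (hn : 2 ≤ n) (α β γ : ℕ) : Subrepresentation (leftAction n) :=
  generated (hwPoly hn α β γ)

end SpHarm

/-! The proof rests on three tools.

Fischer inner product. Multiplication by a variable is adjoint to the corresponding partial
derivative. Hence `dL Y` is adjoint to `dL Yᴴ` (`fischer_dL`), so orthogonal complements of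
invariant subspaces are invariant, and the Laplacian is adjoint to 4 times multiplication by
`normSq` (`fischer_laplacian`). Consequently the Laplacian maps bidegree (α+1, β+1) onto bidegree
(α, β), and no nonzero multiple of `normSq` is harmonic.

Classification of singular vectors. A polynomial killed by the positive root vectors is constant
along the orbits of the unipotent group they generate. A generic orbit meets the slice on which only
w₁, z̄₁, z̄₂, w̄₁ may be nonzero, so a singular polynomial is determined by its coefficients at the
monomials w₁^p z̄₁^a z̄₂^b w̄₁^c. The bidegree and the weight fix p, a, b, c, so each such space of
singular vectors has dimension at most one (`IsSingularVector.eq_smul`). The symmetry `swap` of the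
two groups of variables shows that the space is spanned by `normSq ^ c * hwPoly`, with bidegree
(α-c, β-c) in the second factor; harmonicity forces c = 0. Since a nonzero space stable under the
Lie algebra contains a singular eigenvector, every such subspace of the harmonic space contains some
P_γ (`exists_hwPoly_mem`).

Raising and lowering operators. The maps (z, w) ↦ J(z̄, w̄) and back define derivations `raise` and
`lower` that commute with Sp(n). On V_γ the product of the two is the scalar (α-γ)(β-γ+1), and these
scalars are distinct. This gives independence of the V_γ, and irreducibility: an invariant subspace
of V_γ contains some P_δ, and the scalar forces δ = γ. The V_γ exhaust the harmonic space, because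
the orthogonal complement of their sum would otherwise contain some P_γ orthogonal to itself.

For the dimension, `raise` and `lower` show that dim V_γ depends only on α + β and γ. Comparing two
neighbouring bidegrees isolates V_γ as a difference of two harmonic dimensions, each of which comes
from counting monomials. -/

namespace SpHarm

open MvPolynomial Matrix

/-! ### The Fischer inner product -/

section Fischer

variable {σ : Type*}

/-- The product of the factorials of the exponents of a monomial. -/
def multiFactorial (m : σ →₀ ℕ) : ℕ := m.prod fun _ k => k.factorial

theorem multiFactorial_pos (m : σ →₀ ℕ) : 0 < multiFactorial m :=
  Finset.prod_pos fun _ _ => Nat.factorial_pos _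

theorem multiFactorial_add_single (m : σ →₀ ℕ) (i : σ) :
    multiFactorial (m + Finsupp.single i 1) = (m i + 1) * multiFactorial m := by
  classical
  have h1 := Finsupp.mul_prod_erase' (m + Finsupp.single i 1) i (fun _ k => k.factorial)
    (fun _ => rfl)
  have h2 := Finsupp.mul_prod_erase' m i (fun _ k => k.factorial) (fun _ => rfl)
  have h3 : (m + Finsupp.single i 1).erase i = m.erase i := by
    rw [Finsupp.erase_add, Finsupp.erase_single, add_zero]
  rw [multiFactorial, multiFactorial, ← h1, ← h2, h3]
  simp [Nat.factorial_succ, mul_assoc]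

/-- The Fischer inner product on polynomials, for which distinct monomials are orthogonal. -/
noncomputable def fischer (P Q : MvPolynomial σ ℂ) : ℂ :=
  ∑ m ∈ P.support, star (coeff m P) * coeff m Q * multiFactorial m

theorem fischer_eq_sum {P : MvPolynomial σ ℂ} (Q : MvPolynomial σ ℂ) {s : Finset (σ →₀ ℕ)}
    (hs : P.support ⊆ s) :
    fischer P Q = ∑ m ∈ s, star (coeff m P) * coeff m Q * multiFactorial m := by
  refine Finset.sum_subset hs fun m _ hm => ?_
  rw [notMem_support_iff.mp hm]; simp

theorem fischer_add_left (P P' Q : MvPolynomial σ ℂ) :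
    fischer (P + P') Q = fischer P Q + fischer P' Q := by
  classical
  rw [fischer_eq_sum Q (support_add (p := P) (q := P')),
    fischer_eq_sum Q (Finset.subset_union_left (s₁ := P.support) (s₂ := P'.support)),
    fischer_eq_sum Q (Finset.subset_union_right (s₁ := P.support) (s₂ := P'.support)),
    ← Finset.sum_add_distrib]
  refine Finset.sum_congr rfl fun m _ => ?_
  rw [coeff_add, star_add]; ring

theorem fischer_smul_left (c : ℂ) (P Q : MvPolynomial σ ℂ) :
    fischer (c • P) Q = star c * fischer P Q := by
  rw [fischer_eq_sum Q (support_smul (a := c) (f := P)), fischer, Finset.mul_sum]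
  refine Finset.sum_congr rfl fun m _ => ?_
  rw [coeff_smul, smul_eq_mul, star_mul']; ring

theorem fischer_add_right (P Q Q' : MvPolynomial σ ℂ) :
    fischer P (Q + Q') = fischer P Q + fischer P Q' := by
  simp only [fischer, ← Finset.sum_add_distrib, coeff_add]
  exact Finset.sum_congr rfl fun m _ => by ring

theorem fischer_smul_right (c : ℂ) (P Q : MvPolynomial σ ℂ) :
    fischer P (c • Q) = c * fischer P Q := by
  simp only [fischer, Finset.mul_sum, coeff_smul, smul_eq_mul]
  exact Finset.sum_congr rfl fun m _ => by ring

theorem fischer_zero_right (P : MvPolynomial σ ℂ) : fischer P 0 = 0 := by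
  simp [fischer]

theorem fischer_star (P Q : MvPolynomial σ ℂ) : star (fischer Q P) = fischer P Q := by
  classical
  rw [fischer_eq_sum P (Finset.subset_union_right (s₁ := P.support) (s₂ := Q.support)),
    fischer_eq_sum Q (Finset.subset_union_left (s₁ := P.support) (s₂ := Q.support)), star_sum]
  refine Finset.sum_congr rfl fun m _ => ?_
  simp only [star_mul', star_star, star_natCast]; ring

theorem fischer_self (P : MvPolynomial σ ℂ) :
    fischer P P = ((∑ m ∈ P.support, ‖coeff m P‖ ^ 2 * multiFactorial m : ℝ) : ℂ) := by
  rw [fischer]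
  push_cast
  refine Finset.sum_congr rfl fun m _ => ?_
  rw [Complex.star_def, Complex.conj_mul']

theorem fischer_self_re_nonneg (P : MvPolynomial σ ℂ) : 0 ≤ (fischer P P).re := by
  rw [fischer_self, Complex.ofReal_re]
  positivity

theorem eq_zero_of_fischer_self {P : MvPolynomial σ ℂ} (h : fischer P P = 0) : P = 0 := by
  rw [fischer_self, Complex.ofReal_eq_zero, Finset.sum_eq_zero_iff_of_nonneg
    (fun _ _ => by positivity)] at h
  by_contra hP
  obtain ⟨m, hm⟩ := Finset.nonempty_iff_ne_empty.mpr (mt support_eq_empty.mp hP)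
  have h1 := h m hm
  have h2 : (multiFactorial m : ℝ) ≠ 0 := by exact_mod_cast (multiFactorial_pos m).ne'
  simp only [mul_eq_zero, h2, or_false, pow_eq_zero_iff two_ne_zero, norm_eq_zero] at h1
  exact mem_support_iff.mp hm h1

/-- This is what the factorial weight is for: (m + e_i)! = (m_i + 1) m!, and m_i + 1 is the factor
produced by differentiation. -/
theorem fischer_X_mul (i : σ) (P Q : MvPolynomial σ ℂ) :
    fischer (X i * P) Q = fischer P (pderiv i Q) := by
  classical
  induction P using MvPolynomial.induction_on' with
  | add p q hp hq => rw [mul_add, fischer_add_left, fischer_add_left, hp, hq]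
  | monomial m a =>
    rw [X, monomial_mul, one_mul, fischer_eq_sum Q (support_monomial_subset),
      fischer_eq_sum _ (support_monomial_subset), Finset.sum_singleton, Finset.sum_singleton,
      coeff_monomial, coeff_monomial, if_pos rfl, if_pos rfl, coeff_pderiv, add_comm _ m,
      multiFactorial_add_single]
    push_cast; ring

theorem fischer_pderiv (i : σ) (P Q : MvPolynomial σ ℂ) :
    fischer (pderiv i P) Q = fischer P (X i * Q) := by
  rw [← fischer_star, ← fischer_X_mul, fischer_star]

/-- The Fischer inner product as an inner product space structure. -/
@[reducible] noncomputable def fischerCore : InnerProductSpace.Core ℂ (MvPolynomial σ ℂ) where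
  inner := fischer
  conj_inner_symm P Q := fischer_star P Q
  re_inner_nonneg P := fischer_self_re_nonneg P
  add_left := fischer_add_left
  smul_left P Q c := fischer_smul_left c P Q
  definite _ h := eq_zero_of_fischer_self h

theorem fischer_zero_left (P : MvPolynomial σ ℂ) : fischer 0 P = 0 := by
  simp [fischer]

theorem fischer_sum_left {ι : Type*} (s : Finset ι) (f : ι → MvPolynomial σ ℂ)
    (Q : MvPolynomial σ ℂ) : fischer (∑ i ∈ s, f i) Q = ∑ i ∈ s, fischer (f i) Q :=
  map_sum (AddMonoidHom.mk' (fun P => fischer P Q) fun P P' => fischer_add_left P P' Q) f s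

theorem fischer_sum_right {ι : Type*} (s : Finset ι) (P : MvPolynomial σ ℂ)
    (f : ι → MvPolynomial σ ℂ) : fischer P (∑ i ∈ s, f i) = ∑ i ∈ s, fischer P (f i) :=
  map_sum (AddMonoidHom.mk' (fun Q => fischer P Q) fun Q Q' => fischer_add_right P Q Q') f s

/-- A proper subspace of a finite-dimensional space of polynomials has a nonzero orthogonal
vector. -/
theorem exists_fischer_orthogonal {S H : Submodule ℂ (MvPolynomial σ ℂ)} [FiniteDimensional ℂ H]
    (h : S < H) : ∃ P ∈ H, P ≠ 0 ∧ ∀ Q ∈ S, fischer Q P = 0 := by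
  let _ : NormedAddCommGroup (MvPolynomial σ ℂ) := (fischerCore (σ := σ)).toNormedAddCommGroup
  let _ : InnerProductSpace ℂ (MvPolynomial σ ℂ) :=
    InnerProductSpace.ofCore (fischerCore (σ := σ)).toCore
  have : FiniteDimensional ℂ S := Submodule.finiteDimensional_of_le h.le
  obtain ⟨x, hxH, hxS⟩ := SetLike.exists_of_lt h
  -- The polynomial ring is not complete, but `S` is finite-dimensional, so the orthogonal
  -- projection onto it exists.
  refine ⟨x - S.starProjection x, sub_mem hxH (h.le (Submodule.starProjection_apply_mem S x)), ?_,
    fun Q hQ => ?_⟩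
  · intro h0
    exact hxS (sub_eq_zero.mp h0 ▸ Submodule.starProjection_apply_mem S x)
  · exact (Submodule.mem_orthogonal S _).mp (Submodule.sub_starProjection_mem_orthogonal x) Q hQ

end Fischer

/-! ### Derivations of polynomial rings -/

section Derivations

variable {σ τ : Type*}

theorem pderiv_pderiv_comm (i j : σ) (P : MvPolynomial σ ℂ) :
    pderiv i (pderiv j P) = pderiv j (pderiv i P) := by
  classical
  ext m
  simp only [coeff_pderiv, add_right_comm m (Finsupp.single i 1)]
  by_cases h : i = j
  · subst h; ring
  · simp [h, Ne.symm h]; ring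

/-- The derivation for which each variable is an eigenvector. -/
noncomputable def diagonalDerivation (c : σ → ℂ) :
    Derivation ℂ (MvPolynomial σ ℂ) (MvPolynomial σ ℂ) :=
  mkDerivation ℂ fun i => c i • X i

theorem coeff_diagonalDerivation (c : σ → ℂ) (P : MvPolynomial σ ℂ) (m : σ →₀ ℕ) :
    coeff m (diagonalDerivation c P) = (m.sum fun i k => (k : ℂ) * c i) * coeff m P := by
  classical
  induction P using MvPolynomial.induction_on' with
  | add p q hp hq => simp only [map_add, coeff_add, hp, hq]; ring
  | monomial s a =>
    have h : diagonalDerivation c (monomial s a)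
        = (s.sum fun i k => (k : ℂ) * c i) • monomial s a := by
      rw [diagonalDerivation, mkDerivation_monomial, Finsupp.sum, Finsupp.sum, Finset.sum_smul,
        Finset.smul_sum]
      refine Finset.sum_congr rfl fun i hi => ?_
      have h1 : monomial s a = monomial (s - Finsupp.single i 1) 1 * X i * C a := by
        rw [X, monomial_mul, mul_comm, C_mul_monomial,
          tsub_add_cancel_of_le (Finsupp.single_le_iff.mpr
            (Nat.one_le_iff_ne_zero.mpr (Finsupp.mem_support_iff.mp hi)))]
        simp
      rw [h1]
      have h2 : monomial (s - Finsupp.single i 1) (s i : ℂ)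
          = C (s i : ℂ) * monomial (s - Finsupp.single i 1) 1 := by
        rw [C_mul_monomial, mul_one]
      simp only [h2, smul_eq_C_mul, smul_eq_mul, C_mul]
      ring
    rw [h, coeff_smul, coeff_monomial, smul_eq_mul]
    split_ifs with h1
    · rw [h1]
    · simp

/-- Euler's identity. As an eigenvector condition, homogeneity passes through any algebra
endomorphism that commutes with the Euler derivation. -/
theorem isWeightedHomogeneous_iff_diagonalDerivation (w : σ → ℕ) (d : ℕ)
    (P : MvPolynomial σ ℂ) :
    IsWeightedHomogeneous w P d ↔ diagonalDerivation (fun i => (w i : ℂ)) P = (d : ℂ) • P := by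
  have key : ∀ m : σ →₀ ℕ, (m.sum fun i k => (k : ℂ) * w i) = (Finsupp.weight w m : ℕ) := by
    intro m
    rw [Finsupp.weight_apply, Finsupp.sum, Finsupp.sum]
    push_cast
    simp
  constructor
  · intro h
    ext m
    rw [coeff_diagonalDerivation, key, coeff_smul, smul_eq_mul]
    by_cases hm : coeff m P = 0
    · simp [hm]
    · rw [h hm]
  · intro h m hm
    have h1 := congrArg (coeff m) h
    rw [coeff_diagonalDerivation, key, coeff_smul, smul_eq_mul] at h1
    exact_mod_cast mul_right_cancel₀ hm h1

/-- A derivation along φ is determined by its values on the variables. It yields both the chain rule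
for substitutions and the commutation of derivations with endomorphisms. -/
theorem twisted_derivation_ext (φ : MvPolynomial σ ℂ →ₐ[ℂ] MvPolynomial τ ℂ)
    (D D' : MvPolynomial σ ℂ →ₗ[ℂ] MvPolynomial τ ℂ)
    (hD : ∀ p q, D (p * q) = D p * φ q + φ p * D q)
    (hD' : ∀ p q, D' (p * q) = D' p * φ q + φ p * D' q)
    (h : ∀ i, D (X i) = D' (X i)) (P : MvPolynomial σ ℂ) : D P = D' P := by
  have h1 : ∀ E : MvPolynomial σ ℂ →ₗ[ℂ] MvPolynomial τ ℂ,
      (∀ p q, E (p * q) = E p * φ q + φ p * E q) → ∀ a : ℂ, E (C a) = 0 := by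
    intro E hE a
    -- The Leibniz rule gives E 1 = E 1 + E 1, so constants are killed.
    have := hE 1 1
    simp only [mul_one, map_one, one_mul] at this
    rw [← mul_one (C a), ← smul_eq_C_mul, map_smul]
    rw [left_eq_add.mp this, smul_zero]
  induction P using MvPolynomial.induction_on with
  | C a => rw [h1 D hD, h1 D' hD']
  | add p q hp hq => rw [map_add, map_add, hp, hq]
  | mul_X p i hp => rw [hD, hD', hp, h]

/-- An algebra endomorphism intertwines two derivations if it does so on the variables. -/
theorem derivation_algHom_intertwine (D D' : Derivation ℂ (MvPolynomial σ ℂ) (MvPolynomial σ ℂ))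
    (φ : MvPolynomial σ ℂ →ₐ[ℂ] MvPolynomial σ ℂ) (h : ∀ i, D (φ (X i)) = φ (D' (X i)))
    (P : MvPolynomial σ ℂ) : D (φ P) = φ (D' P) := by
  refine twisted_derivation_ext φ (D.toLinearMap ∘ₗ φ.toLinearMap)
    (φ.toLinearMap ∘ₗ D'.toLinearMap) ?_ ?_ h P
  all_goals
    intro p q
    simp only [LinearMap.comp_apply, AlgHom.toLinearMap_apply, Derivation.coeFn_coe, map_mul,
      Derivation.leibniz, smul_eq_mul, map_add]
    ring

theorem derivation_algHom_comm (D : Derivation ℂ (MvPolynomial σ ℂ) (MvPolynomial σ ℂ))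
    (φ : MvPolynomial σ ℂ →ₐ[ℂ] MvPolynomial σ ℂ) (h : ∀ i, D (φ (X i)) = φ (D (X i)))
    (P : MvPolynomial σ ℂ) : D (φ P) = φ (D P) :=
  derivation_algHom_intertwine D D φ h P

theorem derivation_C_mul_self (D : Derivation ℂ (MvPolynomial σ ℂ) (MvPolynomial σ ℂ)) (a : ℂ)
    (P : MvPolynomial σ ℂ) : D (C a * P) = C a * D P := by
  rw [← smul_eq_C_mul, D.map_smul, smul_eq_C_mul]

theorem derivation_mul_eigen {A : Type*} [CommRing A] [Algebra ℂ A] (D : Derivation ℂ A A)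
    {a b : A} {r s : ℂ} (ha : D a = r • a) (hb : D b = s • b) :
    D (a * b) = (r + s) • (a * b) := by
  rw [Derivation.leibniz, ha, hb, smul_eq_mul, smul_eq_mul, mul_smul_comm, mul_smul_comm,
    mul_comm b a, add_smul, add_comm]

theorem derivation_pow_eigen {A : Type*} [CommRing A] [Algebra ℂ A] (D : Derivation ℂ A A)
    {a : A} {r : ℂ} (ha : D a = r • a) (k : ℕ) : D (a ^ k) = ((k : ℂ) * r) • a ^ k := by
  induction k with
  | zero => simp
  | succ k ih =>
    rw [pow_succ, derivation_mul_eigen D ih ha]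
    push_cast
    rw [add_mul, one_mul]

end Derivations

/-! ### The infinitesimal action, its adjoint, and the Laplacian -/

variable {n : ℕ}

/-- The infinitesimal action as a derivation. -/
noncomputable def dLDerivation (Y : Matrix (Idx n) (Idx n) ℂ) :
    Derivation ℂ (Poly n) (Poly n) :=
  mkDerivation ℂ (Sum.elim (fun i => -∑ j, C (Y i j) * hol j) (fun i => ∑ j, C (Yᵀ i j) * conj j))

theorem dLDerivation_hol (Y : Matrix (Idx n) (Idx n) ℂ) (i : Idx n) :
    dLDerivation Y (hol i) = -∑ j, C (Y i j) * hol j := mkDerivation_X _ _ _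

theorem dLDerivation_conj (Y : Matrix (Idx n) (Idx n) ℂ) (i : Idx n) :
    dLDerivation Y (conj i) = ∑ j, C (Y j i) * conj j := mkDerivation_X _ _ _

theorem dL_eq_dLDerivation (Y : Matrix (Idx n) (Idx n) ℂ) (P : Poly n) :
    dL Y P = dLDerivation Y P := by
  let D : Derivation ℂ (Poly n) (Poly n) :=
    ∑ i, (-∑ j, C (Y i j) * hol j : Poly n) • pderiv (Sum.inl i)
      + ∑ i, (∑ j, C (Yᵀ i j) * conj j : Poly n) • pderiv (Sum.inr i)
  have hD : ∀ P, D P = dL Y P := by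
    intro P
    have hs : ∀ f : Idx n → Derivation ℂ (Poly n) (Poly n), (∑ i, f i) P = ∑ i, f i P := by
      intro f
      rw [← Derivation.coeFnAddMonoidHom_apply, map_sum, Finset.sum_apply]
      rfl
    rw [Derivation.add_apply, hs, hs]
    simp only [dL, Derivation.smul_apply, smul_eq_mul, mul_comm]
  rw [← hD]
  suffices h : D = dLDerivation Y by rw [h]
  apply MvPolynomial.derivation_ext
  rintro (i | i)
  · rw [hD]
    refine Eq.trans ?_ (dLDerivation_hol Y i).symm
    simp [dL, pderiv_X, Pi.single_apply, -Fintype.sum_sum_type]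
  · rw [hD]
    refine Eq.trans ?_ (dLDerivation_conj Y i).symm
    simp [dL, pderiv_X, Pi.single_apply, -Fintype.sum_sum_type]

theorem dL_matrix_add (Y Z : Matrix (Idx n) (Idx n) ℂ) (P : Poly n) :
    dL (Y + Z) P = dL Y P + dL Z P := by
  simp only [dL, Matrix.add_apply, Matrix.transpose_apply, C_add, add_mul, Finset.sum_add_distrib,
    mul_add, neg_add]
  ring

theorem dL_matrix_smul (c : ℂ) (Y : Matrix (Idx n) (Idx n) ℂ) (P : Poly n) :
    dL (c • Y) P = c • dL Y P := by
  simp only [dL, Matrix.smul_apply, Matrix.transpose_apply, smul_eq_mul, C_mul, smul_eq_C_mul,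
    mul_add, Finset.mul_sum, mul_neg, Finset.sum_neg_distrib]
  refine congrArg₂ (· + ·) (congrArg _ ?_) ?_
  · exact Finset.sum_congr rfl fun i _ => Finset.sum_congr rfl fun j _ => by ring
  · exact Finset.sum_congr rfl fun i _ => Finset.sum_congr rfl fun j _ => by ring

/-- Both sides are derivations, so the coordinates suffice. Later it shows that root vectors shift
eigenvalues of a Cartan element. -/
theorem dL_commutator (Y Z : Matrix (Idx n) (Idx n) ℂ) (P : Poly n) :
    dL Y (dL Z P) - dL Z (dL Y P) = dL (Y * Z - Z * Y) P := by
  simp only [dL_eq_dLDerivation]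
  rw [← Derivation.commutator_apply]
  suffices h : ⁅dLDerivation Y, dLDerivation Z⁆ = dLDerivation (Y * Z - Z * Y) by rw [h]
  apply MvPolynomial.derivation_ext
  rintro (i | i)
  · rw [Derivation.commutator_apply]
    change dLDerivation Y (dLDerivation Z (hol i)) - dLDerivation Z (dLDerivation Y (hol i))
      = dLDerivation _ (hol i)
    simp only [dLDerivation_hol, map_neg, map_sum, derivation_C_mul_self,
      Matrix.sub_apply, Matrix.mul_apply, C_sub, sub_mul, Finset.sum_sub_distrib, C_mul,
      Finset.sum_mul, Finset.mul_sum, mul_neg, Finset.sum_neg_distrib, neg_neg, ← mul_assoc]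
    rw [neg_sub]
    refine congrArg₂ (· - ·) ?_ ?_
    all_goals
      exact Finset.sum_comm
  · rw [Derivation.commutator_apply]
    change dLDerivation Y (dLDerivation Z (conj i)) - dLDerivation Z (dLDerivation Y (conj i))
      = dLDerivation _ (conj i)
    simp only [dLDerivation_conj, map_sum, derivation_C_mul_self,
      Matrix.sub_apply, Matrix.mul_apply, C_sub, sub_mul, Finset.sum_sub_distrib, C_mul,
      Finset.sum_mul, Finset.mul_sum]
    refine congrArg₂ (· - ·) ?_ ?_
    all_goals
      rw [Finset.sum_comm]
      exact Finset.sum_congr rfl fun i _ => Finset.sum_congr rfl fun j _ => by ring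

theorem dL_diagonal (d : Idx n → ℂ) (P : Poly n) :
    dL (Matrix.diagonal d) P = diagonalDerivation (Sum.elim (-d) d) P := by
  rw [dL_eq_dLDerivation]
  suffices h : dLDerivation (Matrix.diagonal d) = diagonalDerivation (Sum.elim (-d) d) by rw [h]
  apply MvPolynomial.derivation_ext
  rintro (i | i)
  · refine (dLDerivation_hol _ i).trans ?_
    simp [-Fintype.sum_sum_type, diagonalDerivation, mkDerivation_X, Matrix.diagonal_apply,
      apply_ite C, hol, smul_eq_C_mul]
  · refine (dLDerivation_conj _ i).trans ?_
    simp [-Fintype.sum_sum_type, diagonalDerivation, mkDerivation_X, Matrix.diagonal_apply,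
      apply_ite C, conj, smul_eq_C_mul]

/-- `dL Y` is a combination of operators x_j ∂_i, and the adjoint of x_j ∂_i is x_i ∂_j. -/
theorem fischer_dL (Y : Matrix (Idx n) (Idx n) ℂ) (P Q : Poly n) :
    fischer (dL Y P) Q = fischer P (dL Yᴴ Q) := by
  have h1 : ∀ (Y : Matrix (Idx n) (Idx n) ℂ) (P : Poly n), dL Y P
      = ∑ i, ∑ j, (-Y i j) • (X (Sum.inl j) * pderiv (Sum.inl i) P)
        + ∑ i, ∑ j, Y j i • (X (Sum.inr j) * pderiv (Sum.inr i) P) := by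
    intro Y P
    simp only [dL, Matrix.transpose_apply, Finset.mul_sum, hol, conj, ← Finset.sum_neg_distrib,
      mul_neg, neg_smul, smul_eq_C_mul]
    refine congrArg₂ (· + ·) ?_ ?_
    · exact Finset.sum_congr rfl fun i _ => Finset.sum_congr rfl fun j _ => by ring
    · exact Finset.sum_congr rfl fun i _ => Finset.sum_congr rfl fun j _ => by ring
  rw [h1, h1]
  simp only [fischer_add_left, fischer_sum_left, fischer_smul_left, fischer_add_right,
    fischer_sum_right, fischer_smul_right, fischer_X_mul, fischer_pderiv,
    Matrix.conjTranspose_apply, star_neg]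
  simp only [← fischer_pderiv]
  rw [Finset.sum_comm, add_right_inj, Finset.sum_comm]

/-- The squared norm `∑ (z_r z̄_r + w_r w̄_r)`. -/
noncomputable def normSq (n : ℕ) : Poly n := ∑ i, hol i * conj i

theorem fischer_laplacian (P Q : Poly n) :
    fischer (laplacian n P) Q = 4 * fischer P (normSq n * Q) := by
  simp only [laplacian, LinearMap.smul_apply, LinearMap.sum_apply, LinearMap.comp_apply,
    Derivation.coeFn_coe, fischer_smul_left, fischer_sum_left, fischer_pderiv, normSq,
    Finset.sum_mul, fischer_sum_right, hol, conj]
  refine congrArg₂ (· * ·) ?_ ?_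
  · simp
  · exact Finset.sum_congr rfl fun i _ => by rw [mul_left_comm, mul_assoc]

/-- The action on the conjugate variables is contragredient to that on (z, w), so their pairing is
fixed by every matrix, symplectic or not. -/
theorem dL_normSq (Y : Matrix (Idx n) (Idx n) ℂ) : dL Y (normSq n) = 0 := by
  rw [dL_eq_dLDerivation, normSq, map_sum]
  simp only [Derivation.leibniz, dLDerivation_hol, dLDerivation_conj, smul_eq_mul,
    Finset.sum_add_distrib, mul_neg, Finset.mul_sum, Finset.sum_neg_distrib]
  rw [Finset.sum_comm, ← sub_eq_add_neg, sub_eq_zero]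
  exact Finset.sum_congr rfl fun i _ => Finset.sum_congr rfl fun j _ => by ring

/-! ### Invariance of the harmonic space under Sp(n) -/

theorem subst_hol (A B : Matrix (Idx n) (Idx n) ℂ) (i : Idx n) :
    subst A B (hol i) = ∑ j, C (A i j) * hol j := aeval_X _ _

theorem subst_conj (A B : Matrix (Idx n) (Idx n) ℂ) (i : Idx n) :
    subst A B (conj i) = ∑ j, C (B i j) * conj j := aeval_X _ _

theorem pderiv_inl_subst (A B : Matrix (Idx n) (Idx n) ℂ) (j : Idx n) (P : Poly n) :
    pderiv (Sum.inl j) (subst A B P) = ∑ i, C (A i j) * subst A B (pderiv (Sum.inl i) P) := by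
  have := twisted_derivation_ext (subst A B)
    ((pderiv (R := ℂ) (Sum.inl j)).toLinearMap ∘ₗ (subst A B).toLinearMap)
    (∑ i, A i j • ((subst A B).toLinearMap ∘ₗ (pderiv (Sum.inl i)).toLinearMap)) ?_ ?_ ?_ P
  · simpa [smul_eq_C_mul] using this
  · intro p q
    simp only [LinearMap.comp_apply, AlgHom.toLinearMap_apply, Derivation.coeFn_coe, map_mul,
      Derivation.leibniz, smul_eq_mul]
    ring
  · intro p q
    simp only [LinearMap.sum_apply, LinearMap.smul_apply, LinearMap.comp_apply,
      AlgHom.toLinearMap_apply, Derivation.coeFn_coe, map_mul, map_add,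
      Derivation.leibniz, smul_eq_mul, smul_eq_C_mul, Finset.sum_mul, Finset.mul_sum,
      ← Finset.sum_add_distrib]
    exact Finset.sum_congr rfl fun i _ => by ring
  · rintro (i | i)
    · change pderiv (Sum.inl j) (subst A B (hol i)) = _
      rw [subst_hol]
      simp [-Fintype.sum_sum_type, hol, pderiv_X, Pi.single_apply, smul_eq_C_mul]
    · change pderiv (Sum.inl j) (subst A B (conj i)) = _
      rw [subst_conj]
      simp [-Fintype.sum_sum_type, conj, pderiv_X]

theorem pderiv_inr_subst (A B : Matrix (Idx n) (Idx n) ℂ) (j : Idx n) (P : Poly n) :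
    pderiv (Sum.inr j) (subst A B P) = ∑ i, C (B i j) * subst A B (pderiv (Sum.inr i) P) := by
  have := twisted_derivation_ext (subst A B)
    ((pderiv (R := ℂ) (Sum.inr j)).toLinearMap ∘ₗ (subst A B).toLinearMap)
    (∑ i, B i j • ((subst A B).toLinearMap ∘ₗ (pderiv (Sum.inr i)).toLinearMap)) ?_ ?_ ?_ P
  · simpa [smul_eq_C_mul] using this
  · intro p q
    simp only [LinearMap.comp_apply, AlgHom.toLinearMap_apply, Derivation.coeFn_coe, map_mul,
      Derivation.leibniz, smul_eq_mul]
    ring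
  · intro p q
    simp only [LinearMap.sum_apply, LinearMap.smul_apply, LinearMap.comp_apply,
      AlgHom.toLinearMap_apply, Derivation.coeFn_coe, map_mul, map_add,
      Derivation.leibniz, smul_eq_mul, smul_eq_C_mul, Finset.sum_mul, Finset.mul_sum,
      ← Finset.sum_add_distrib]
    exact Finset.sum_congr rfl fun i _ => by ring
  · rintro (i | i)
    · change pderiv (Sum.inr j) (subst A B (hol i)) = _
      rw [subst_hol]
      simp [-Fintype.sum_sum_type, hol, pderiv_X]
    · change pderiv (Sum.inr j) (subst A B (conj i)) = _
      rw [subst_conj]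
      simp [-Fintype.sum_sum_type, conj, pderiv_X, Pi.single_apply, smul_eq_C_mul]

/-- The chain rule produces the coefficients ∑_j A i j * B k j, the entries of A Bᵀ. For the left
action A = u⁻¹ and B = ᵗu, so the condition holds. -/
theorem laplacian_subst {A B : Matrix (Idx n) (Idx n) ℂ} (h : A * Bᵀ = 1) (P : Poly n) :
    laplacian n (subst A B P) = subst A B (laplacian n P) := by
  have hAB : ∀ i k, ∑ j, C (A i j) * C (B k j) = if i = k then (1 : Poly n) else 0 := by
    intro i k
    have := congrArg (fun M => (C (M i k) : Poly n)) h
    simpa [Matrix.mul_apply, Matrix.one_apply, apply_ite C] using this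
  simp only [laplacian, LinearMap.smul_apply, LinearMap.sum_apply, LinearMap.comp_apply,
    Derivation.coeFn_coe, map_smul, map_sum]
  refine congrArg _ ?_
  have h1 : ∀ j : Idx n, pderiv (Sum.inl j) (pderiv (Sum.inr j) (subst A B P))
      = ∑ k, ∑ i, C (A i j) * C (B k j) *
        subst A B (pderiv (Sum.inl i) (pderiv (Sum.inr k) P)) := by
    intro j
    rw [pderiv_inr_subst, map_sum]
    refine Finset.sum_congr rfl fun k _ => ?_
    rw [pderiv_C_mul, pderiv_inl_subst, Finset.mul_sum]
    exact Finset.sum_congr rfl fun i _ => by ring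
  simp only [h1]
  rw [Finset.sum_comm]
  refine Finset.sum_congr rfl fun k _ => ?_
  rw [Finset.sum_comm]
  simp only [← Finset.sum_mul, hAB, ite_mul, one_mul, zero_mul, Finset.sum_ite_eq',
    Finset.mem_univ, if_true]

theorem mem_harmonic {α β : ℕ} {P : Poly n} : P ∈ harmonic n α β ↔
    IsWeightedHomogeneous (holWeight n) P α ∧ IsWeightedHomogeneous (conjWeight n) P β ∧
      laplacian n P = 0 := by
  simp [harmonic, Submodule.mem_inf, mem_weightedHomogeneousSubmodule, and_assoc]

theorem leftAction_apply (u : Sp n) (P : Poly n) :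
    leftAction n u P = subst (Sp.mat u⁻¹) (Sp.mat u)ᵀ P := rfl

theorem Sp.mat_inv_mul (u : Sp n) : Sp.mat u⁻¹ * Sp.mat u = 1 :=
  congrArg Sp.mat (inv_mul_cancel u)

/-- The substitution is linear within each of the two groups of variables, so it commutes with both
Euler derivations. -/
theorem leftAction_mem_harmonic {α β : ℕ} (u : Sp n) {P : Poly n} (hP : P ∈ harmonic n α β) :
    leftAction n u P ∈ harmonic n α β := by
  rw [mem_harmonic] at hP ⊢
  obtain ⟨h1, h2, h3⟩ := hP
  rw [isWeightedHomogeneous_iff_diagonalDerivation] at h1 h2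
  rw [isWeightedHomogeneous_iff_diagonalDerivation, isWeightedHomogeneous_iff_diagonalDerivation,
    leftAction_apply]
  refine ⟨?_, ?_, ?_⟩
  · rw [derivation_algHom_comm, h1, map_smul]
    rintro (i | i)
    · change diagonalDerivation _ (subst _ _ (hol i)) = _
      simp [subst, hol, diagonalDerivation, mkDerivation_X, holWeight, smul_eq_C_mul]
    · change diagonalDerivation _ (subst _ _ (conj i)) = _
      simp [subst, conj, diagonalDerivation, mkDerivation_X, holWeight, smul_eq_C_mul]
  · rw [derivation_algHom_comm, h2, map_smul]
    rintro (i | i)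
    · change diagonalDerivation _ (subst _ _ (hol i)) = _
      simp [subst, hol, diagonalDerivation, mkDerivation_X, conjWeight, smul_eq_C_mul]
    · change diagonalDerivation _ (subst _ _ (conj i)) = _
      simp [subst, conj, diagonalDerivation, mkDerivation_X, conjWeight, smul_eq_C_mul]
  · rw [laplacian_subst, h3, map_zero]
    rw [Matrix.transpose_transpose, Sp.mat_inv_mul]

/-! ### Raising and lowering operators -/

theorem sum_C_mul_sum_C_mul (A B : Matrix (Idx n) (Idx n) ℂ) (v : Idx n → Poly n) (i : Idx n) :
    ∑ j, C (A i j) * ∑ k, C (B j k) * v k = ∑ k, C ((A * B) i k) * v k := by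
  simp only [Matrix.mul_apply, map_sum, Finset.sum_mul, Finset.mul_sum, C_mul, mul_assoc]
  exact Finset.sum_comm

/-- The derivation `w_r ↦ z̄_r`, `z_r ↦ -w̄_r`, vanishing on the conjugate variables. -/
noncomputable def raise (n : ℕ) : Derivation ℂ (Poly n) (Poly n) :=
  mkDerivation ℂ (Sum.elim (fun i => ∑ j, C (Matrix.J (Fin n) ℂ i j) * conj j) 0)

/-- The derivation `z̄_r ↦ w_r`, `w̄_r ↦ -z_r`, vanishing on the holomorphic variables. -/
noncomputable def lower (n : ℕ) : Derivation ℂ (Poly n) (Poly n) :=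
  mkDerivation ℂ (Sum.elim 0 (fun i => -∑ j, C (Matrix.J (Fin n) ℂ i j) * hol j))

theorem raise_hol (i : Idx n) : raise n (hol i) = ∑ j, C (Matrix.J (Fin n) ℂ i j) * conj j :=
  mkDerivation_X _ _ _

theorem raise_conj (i : Idx n) : raise n (conj i) = 0 := mkDerivation_X _ _ _

theorem lower_hol (i : Idx n) : lower n (hol i) = 0 := mkDerivation_X _ _ _

theorem lower_conj (i : Idx n) : lower n (conj i) = -∑ j, C (Matrix.J (Fin n) ℂ i j) * hol j :=
  mkDerivation_X _ _ _

theorem raise_hol_inr (r : Fin n) : raise n (hol (.inr r)) = conj (.inl r) := by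
  simp [raise_hol, Matrix.J, Matrix.one_apply, apply_ite C]

theorem lower_conj_inl (r : Fin n) : lower n (conj (.inl r)) = hol (.inr r) := by
  simp [lower_conj, Matrix.J, Matrix.one_apply, apply_ite C]

/-- From u J ᵗu = J follows u⁻¹ J = J ᵗu: the vectors (z, w) and J(z̄, w̄) transform in the same
way. -/
theorem raise_leftAction (u : Sp n) (P : Poly n) :
    raise n (leftAction n u P) = leftAction n u (raise n P) := by
  have hu : Sp.mat u⁻¹ * Matrix.J (Fin n) ℂ = Matrix.J (Fin n) ℂ * (Sp.mat u)ᵀ := by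
    have h := (SymplecticGroup.mem_iff (A := Sp.mat u)).mp u.2
    calc _ = Sp.mat u⁻¹ * (Sp.mat u * Matrix.J (Fin n) ℂ * (Sp.mat u)ᵀ) := by rw [h]
      _ = _ := by rw [Matrix.mul_assoc, ← Matrix.mul_assoc, Sp.mat_inv_mul, Matrix.one_mul]
  refine derivation_algHom_comm (raise n) (subst (Sp.mat u⁻¹) (Sp.mat u)ᵀ) ?_ P
  rintro (i | i)
  · change raise n (subst _ _ (hol i)) = subst _ _ (raise n (hol i))
    simp only [subst_hol, raise_hol, map_sum, derivation_C_mul_self, map_mul, algHom_C,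
      algebraMap_eq, subst_conj]
    rw [sum_C_mul_sum_C_mul, sum_C_mul_sum_C_mul, hu]
  · change raise n (subst _ _ (conj i)) = subst _ _ (raise n (conj i))
    simp only [subst_conj, raise_conj, map_sum, derivation_C_mul_self, map_zero, mul_zero,
      Finset.sum_const_zero]

theorem lower_leftAction (u : Sp n) (P : Poly n) :
    lower n (leftAction n u P) = leftAction n u (lower n P) := by
  have hu : (Sp.mat u)ᵀ * Matrix.J (Fin n) ℂ = Matrix.J (Fin n) ℂ * Sp.mat u⁻¹ := by
    have h := (SymplecticGroup.mem_iff' (A := Sp.mat u)).mp u.2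
    have h2 : Sp.mat u * Sp.mat u⁻¹ = 1 := congrArg Sp.mat (mul_inv_cancel u)
    calc _ = (Sp.mat u)ᵀ * Matrix.J (Fin n) ℂ * Sp.mat u * Sp.mat u⁻¹ := by
          rw [Matrix.mul_assoc _ (Sp.mat u), h2, Matrix.mul_one]
      _ = _ := by rw [h]
  refine derivation_algHom_comm (lower n) (subst (Sp.mat u⁻¹) (Sp.mat u)ᵀ) ?_ P
  rintro (i | i)
  · change lower n (subst _ _ (hol i)) = subst _ _ (lower n (hol i))
    simp only [subst_hol, lower_hol, map_sum, derivation_C_mul_self, map_zero, mul_zero,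
      Finset.sum_const_zero]
  · change lower n (subst _ _ (conj i)) = subst _ _ (lower n (conj i))
    simp only [subst_conj, lower_conj, map_sum, derivation_C_mul_self, map_mul, algHom_C,
      algebraMap_eq, subst_hol, map_neg, mul_neg, Finset.sum_neg_distrib]
    rw [sum_C_mul_sum_C_mul, sum_C_mul_sum_C_mul, hu]

/-! ### The polynomials P_γ as highest weight vectors -/

/-- The `2 × 2` minor `w₂ z̄₁ - w₁ z̄₂`. -/
noncomputable def minor (hn : 2 ≤ n) : Poly n :=
  hol (.inr ⟨1, hn⟩) * conj (.inl ⟨0, Nat.zero_lt_of_lt hn⟩)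
    - hol (.inr ⟨0, Nat.zero_lt_of_lt hn⟩) * conj (.inl ⟨1, hn⟩)

theorem hwPoly_eq (hn : 2 ≤ n) (α β γ : ℕ) : hwPoly hn α β γ =
    hol (.inr ⟨0, Nat.zero_lt_of_lt hn⟩) ^ (α - γ) * conj (.inl ⟨0, Nat.zero_lt_of_lt hn⟩) ^ (β - γ) *
      minor hn ^ γ :=
  rfl

theorem minor_ne_zero (hn : 2 ≤ n) : minor hn ≠ 0 := by
  intro h
  have := congrArg (eval (Sum.elim
    (Sum.elim 0 fun r : Fin n => if r = ⟨1, hn⟩ then (1 : ℂ) else 0)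
    (Sum.elim (fun r : Fin n => if r = ⟨0, Nat.zero_lt_of_lt hn⟩ then (1 : ℂ) else 0) 0))) h
  simp [minor, hol, conj] at this

theorem hwPoly_ne_zero (hn : 2 ≤ n) (α β γ : ℕ) : hwPoly hn α β γ ≠ 0 := by
  rw [hwPoly_eq]
  exact mul_ne_zero (mul_ne_zero (pow_ne_zero _ (X_ne_zero _)) (pow_ne_zero _ (X_ne_zero _)))
    (pow_ne_zero _ (minor_ne_zero hn))

/-- P_γ is a product of powers of three factors. One computation then serves for weights, root
vectors, Euler derivations and partial derivatives, each time with the factors as eigenvectors. -/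
theorem derivation_hwPoly (hn : 2 ≤ n) (D : Derivation ℂ (Poly n) (Poly n)) {a b c : ℂ}
    (ha : D (hol (.inr ⟨0, Nat.zero_lt_of_lt hn⟩)) = a • hol (.inr ⟨0, Nat.zero_lt_of_lt hn⟩))
    (hb : D (conj (.inl ⟨0, Nat.zero_lt_of_lt hn⟩)) = b • conj (.inl ⟨0, Nat.zero_lt_of_lt hn⟩))
    (hc : D (minor hn) = c • minor hn) (α β γ : ℕ) :
    D (hwPoly hn α β γ)
      = (((α - γ : ℕ) : ℂ) * a + ((β - γ : ℕ) : ℂ) * b + γ * c) • hwPoly hn α β γ :=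
  derivation_mul_eigen D (derivation_mul_eigen D (derivation_pow_eigen D ha _)
    (derivation_pow_eigen D hb _)) (derivation_pow_eigen D hc _)

/-- The minor is, up to sign, the determinant with rows (w₁, w₂) and (z̄₁, z̄₂); `raise` turns the
first row into the second. -/
theorem raise_minor (hn : 2 ≤ n) : raise n (minor hn) = 0 := by
  simp only [minor, map_sub, Derivation.leibniz, raise_hol_inr, raise_conj, smul_eq_mul]
  ring

theorem lower_minor (hn : 2 ≤ n) : lower n (minor hn) = 0 := by
  simp only [minor, map_sub, Derivation.leibniz, lower_conj_inl, lower_hol, smul_eq_mul]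
  ring

/-- Only w₁^(a+1) z̄₁^b is affected, as in the standard action of sl₂ on binary forms. Writing the
degrees as sums with γ keeps truncated subtraction out. -/
theorem raise_hwPoly (hn : 2 ≤ n) (a b γ : ℕ) :
    raise n (hwPoly hn (a + 1 + γ) (b + γ) γ)
      = ((a : ℂ) + 1) • hwPoly hn (a + γ) (b + 1 + γ) γ := by
  simp only [hwPoly_eq, Nat.add_sub_cancel, Derivation.leibniz, Derivation.leibniz_pow,
    raise_minor, raise_conj, raise_hol_inr, smul_eq_mul,
    nsmul_eq_mul, smul_eq_C_mul, C_add, C_1, Nat.cast_add, Nat.cast_one, map_natCast]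
  ring

theorem raise_hwPoly_self (hn : 2 ≤ n) (b γ : ℕ) : raise n (hwPoly hn γ (b + γ) γ) = 0 := by
  simp only [hwPoly_eq, Nat.sub_self, pow_zero, one_mul, Derivation.leibniz,
    Derivation.leibniz_pow, raise_minor, raise_conj, smul_zero, add_zero]

theorem lower_hwPoly (hn : 2 ≤ n) (a b γ : ℕ) :
    lower n (hwPoly hn (a + γ) (b + 1 + γ) γ)
      = ((b : ℂ) + 1) • hwPoly hn (a + 1 + γ) (b + γ) γ := by
  simp only [hwPoly_eq, Nat.add_sub_cancel, Derivation.leibniz, Derivation.leibniz_pow,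
    lower_minor, lower_conj_inl, lower_hol, smul_eq_mul,
    nsmul_eq_mul, smul_eq_C_mul, C_add, C_1, Nat.cast_add, Nat.cast_one, map_natCast]
  ring

theorem lower_raise_hwPoly (hn : 2 ≤ n) {α β γ : ℕ} (hα : γ ≤ α) (hβ : γ ≤ β) :
    lower n (raise n (hwPoly hn α β γ))
      = (((α - γ) * (β - γ + 1) : ℕ) : ℂ) • hwPoly hn α β γ := by
  obtain ⟨a, rfl⟩ := Nat.exists_eq_add_of_le' hα
  obtain ⟨b, rfl⟩ := Nat.exists_eq_add_of_le' hβ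
  rcases a with _ | a
  · simp [raise_hwPoly_self]
  · rw [raise_hwPoly, (lower n).map_smul, lower_hwPoly, smul_smul]
    simp

/-- On the variables w_k and z̄_k the roots L_r + L_s and 2L_r act by zero, while L_r - L_s replaces
the index s by r < s. Thus index 1 is killed, and replacing index 2 by 1 gives the minor two equal
columns. -/
theorem dLDerivation_positiveRoot (hn : 2 ≤ n) {Y : Matrix (Idx n) (Idx n) ℂ}
    (hY : IsPositiveRootVector Y) :
    dLDerivation Y (hol (.inr ⟨0, Nat.zero_lt_of_lt hn⟩)) = 0 ∧
      dLDerivation Y (conj (.inl ⟨0, Nat.zero_lt_of_lt hn⟩)) = 0 ∧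
      dLDerivation Y (minor hn) = 0 := by
  have key : (∀ k, dLDerivation Y (hol (.inr k)) = 0) →
      (∀ k, dLDerivation Y (conj (.inl k)) = 0) →
      dLDerivation Y (hol (.inr ⟨0, Nat.zero_lt_of_lt hn⟩)) = 0 ∧
      dLDerivation Y (conj (.inl ⟨0, Nat.zero_lt_of_lt hn⟩)) = 0 ∧
      dLDerivation Y (minor hn) = 0 := by
    intro h1 h2
    refine ⟨h1 _, h2 _, ?_⟩
    simp only [minor, map_sub, Derivation.leibniz, h1, h2, smul_zero, add_zero, sub_zero]
  cases hY with
  | sub r s h =>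
    have h1 : ∀ k, dLDerivation (E (.inl r) (.inl s) - E (.inr s) (.inr r)) (hol (.inr k))
        = if s = k then (hol (.inr r) : Poly n) else 0 := by
      intro k
      simp [dLDerivation_hol, E, Matrix.single_apply, apply_ite C, ite_and]
    have h2 : ∀ k, dLDerivation (E (.inl r) (.inl s) - E (.inr s) (.inr r)) (conj (.inl k))
        = if s = k then (conj (.inl r) : Poly n) else 0 := by
      intro k
      simp [dLDerivation_conj, E, Matrix.single_apply, apply_ite C, ite_and]
    have hs : s ≠ ⟨0, Nat.zero_lt_of_lt hn⟩ := by
      intro hs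
      rw [hs] at h
      exact Nat.not_lt_zero _ h
    refine ⟨by rw [h1, if_neg hs], by rw [h2, if_neg hs], ?_⟩
    simp only [minor, map_sub, Derivation.leibniz, h1, h2, smul_eq_mul, if_neg hs]
    split_ifs with h3
    · have hr : r = ⟨0, Nat.zero_lt_of_lt hn⟩ := by
        rw [h3] at h
        exact Fin.ext (Nat.lt_one_iff.mp h)
      rw [hr]
      ring
    · ring
  | add r s h =>
    apply key <;> intro k <;>
      simp [dLDerivation_hol, dLDerivation_conj, E]
  | two r =>
    apply key <;> intro k <;>
      simp [dLDerivation_hol, dLDerivation_conj, E]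

theorem hwPoly_annihilated (hn : 2 ≤ n) (α β γ : ℕ) {Y : Matrix (Idx n) (Idx n) ℂ}
    (hY : IsPositiveRootVector Y) : dL Y (hwPoly hn α β γ) = 0 := by
  obtain ⟨h1, h2, h3⟩ := dLDerivation_positiveRoot hn hY
  rw [dL_eq_dLDerivation, derivation_hwPoly hn _ (a := 0) (b := 0) (c := 0) (by simp [h1])
    (by simp [h2]) (by simp [h3])]
  simp

theorem dL_diagonal_hwPoly (hn : 2 ≤ n) (d : Fin n → ℂ) {α β γ : ℕ} (hα : γ ≤ α) (hβ : γ ≤ β) :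
    dL (Matrix.diagonal (Sum.elim d (-d))) (hwPoly hn α β γ)
      = (((α : ℂ) + β - γ) * d ⟨0, Nat.zero_lt_of_lt hn⟩ + γ * d ⟨1, hn⟩) • hwPoly hn α β γ := by
  have h1 : ∀ r, dLDerivation (Matrix.diagonal (Sum.elim d (-d))) (hol (.inr r))
      = d r • (hol (.inr r) : Poly n) := by
    intro r
    simp [dLDerivation_hol, Matrix.diagonal_apply, apply_ite C, smul_eq_C_mul]
  have h2 : ∀ r, dLDerivation (Matrix.diagonal (Sum.elim d (-d))) (conj (.inl r))
      = d r • (conj (.inl r) : Poly n) := by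
    intro r
    simp [dLDerivation_conj, Matrix.diagonal_apply, apply_ite C, smul_eq_C_mul]
  rw [dL_eq_dLDerivation, derivation_hwPoly hn _ (h1 _) (h2 _)
    (c := d ⟨0, Nat.zero_lt_of_lt hn⟩ + d ⟨1, hn⟩)]
  · congr 1
    rw [Nat.cast_sub hα, Nat.cast_sub hβ]
    ring
  · rw [minor, map_sub, derivation_mul_eigen _ (h1 _) (h2 _), derivation_mul_eigen _ (h1 _) (h2 _),
      smul_sub, add_comm]

theorem isHighestWeightVector_hwPoly (hn : 2 ≤ n) {k α β γ : ℕ} (hk : k = α + β) (hα : γ ≤ α)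
    (hβ : γ ≤ β) :
    IsHighestWeightVector (((k : ℂ) - (γ : ℂ)) • L (⟨0, Nat.zero_lt_of_lt hn⟩ : Fin n)
      + (γ : ℂ) • L (⟨1, hn⟩ : Fin n)) (hwPoly hn α β γ) where
  ne_zero := hwPoly_ne_zero hn α β γ
  annihilated _ hY := hwPoly_annihilated hn α β γ hY
  weight := by
    rintro ⟨H, ⟨A, B, C, hB, hC, rfl⟩, hH⟩
    have h : Matrix.fromBlocks A C B (-Aᵀ)
        = Matrix.diagonal (Sum.elim (fun r => A r r) (-fun r => A r r)) := by
      rw [← hH.diagonal_diag]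
      congr 1
      ext (i | i) <;> simp
    simp only [h, dL_diagonal_hwPoly hn _ hα hβ]
    rw [hk, Nat.cast_add]
    rfl

theorem hwPoly_mem_harmonic (hn : 2 ≤ n) {α β γ : ℕ} (hα : γ ≤ α) (hβ : γ ≤ β) :
    hwPoly hn α β γ ∈ harmonic n α β := by
  rw [mem_harmonic]
  refine ⟨?_, ?_, ?_⟩
  · have h1 : ∀ i, diagonalDerivation (fun i => (holWeight n i : ℂ)) (hol i)
        = (1 : ℂ) • hol i := fun i => by
      simp [diagonalDerivation, hol, mkDerivation_X, holWeight]
    have h2 : ∀ i, diagonalDerivation (fun i => (holWeight n i : ℂ)) (conj i)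
        = (0 : ℂ) • conj i := fun i => by
      simp [diagonalDerivation, conj, mkDerivation_X, holWeight]
    rw [isWeightedHomogeneous_iff_diagonalDerivation, derivation_hwPoly hn _ (h1 _) (h2 _) (c := 1)]
    · rw [Nat.cast_sub hα]; congr 1; ring
    · rw [minor, map_sub, derivation_mul_eigen _ (h1 _) (h2 _),
        derivation_mul_eigen _ (h1 _) (h2 _), smul_sub, add_zero]
  · have h1 : ∀ i, diagonalDerivation (fun i => (conjWeight n i : ℂ)) (hol i)
        = (0 : ℂ) • hol i := fun i => by
      simp [diagonalDerivation, hol, mkDerivation_X, conjWeight]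
    have h2 : ∀ i, diagonalDerivation (fun i => (conjWeight n i : ℂ)) (conj i)
        = (1 : ℂ) • conj i := fun i => by
      simp [diagonalDerivation, conj, mkDerivation_X, conjWeight]
    rw [isWeightedHomogeneous_iff_diagonalDerivation, derivation_hwPoly hn _ (h1 _) (h2 _) (c := 1)]
    · rw [Nat.cast_sub hβ]; congr 1; ring
    · rw [minor, map_sub, derivation_mul_eigen _ (h1 _) (h2 _),
        derivation_mul_eigen _ (h1 _) (h2 _), smul_sub, zero_add]
  -- P_γ involves only w and z̄, so one of the two derivatives in each term of the Laplacian kills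
  -- it.
  · have h1 : ∀ r : Fin n, pderiv (Sum.inl (Sum.inl r)) (hwPoly hn α β γ) = 0 := by
      intro r
      rw [derivation_hwPoly hn (pderiv (Sum.inl (Sum.inl r))) (a := 0) (b := 0) (c := 0)] <;>
        simp [minor, hol, conj, pderiv_X, Derivation.leibniz]
    have h2 : ∀ r : Fin n, pderiv (Sum.inr (Sum.inr r)) (hwPoly hn α β γ) = 0 := by
      intro r
      rw [derivation_hwPoly hn (pderiv (Sum.inr (Sum.inr r))) (a := 0) (b := 0) (c := 0)] <;>
        simp [minor, hol, conj, pderiv_X, Derivation.leibniz]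
    simp only [laplacian, LinearMap.smul_apply, LinearMap.sum_apply, LinearMap.comp_apply,
      Derivation.coeFn_coe]
    rw [Finset.sum_eq_zero, smul_zero]
    rintro (r | r) -
    · rw [pderiv_pderiv_comm, h1, map_zero]
    · rw [h2, map_zero]

/-! ### Invariant subspaces: from the group to its complexified Lie algebra -/

theorem V_le_harmonic (hn : 2 ≤ n) {α β γ : ℕ} (hα : γ ≤ α) (hβ : γ ≤ β) :
    (V hn α β γ).toSubmodule ≤ harmonic n α β := by
  refine Submodule.span_le.mpr ?_
  rintro _ ⟨u, rfl⟩
  exact leftAction_mem_harmonic u (hwPoly_mem_harmonic hn hα hβ)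

theorem hwPoly_mem_V (hn : 2 ≤ n) (α β γ : ℕ) : hwPoly hn α β γ ∈ (V hn α β γ).toSubmodule :=
  Submodule.subset_span ⟨1, by simp⟩

theorem V_le (hn : 2 ≤ n) {α β γ : ℕ} {W : Submodule ℂ (Poly n)}
    (hW : ∀ u : Sp n, ∀ P ∈ W, leftAction n u P ∈ W) (h : hwPoly hn α β γ ∈ W) :
    (V hn α β γ).toSubmodule ≤ W := by
  refine Submodule.span_le.mpr ?_
  rintro _ ⟨u, rfl⟩
  exact hW u _ h

/-- Differentiability is tested on linear functionals, so no topology on polynomials is needed. The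
functional is quantified inside the induction because multiplication by a variable is absorbed into
it. -/
theorem hasDerivAt_apply_subst {A B : ℝ → Matrix (Idx n) (Idx n) ℂ}
    {Y : Matrix (Idx n) (Idx n) ℂ} (hA0 : A 0 = 1) (hB0 : B 0 = 1)
    (hA : ∀ i j, HasDerivAt (fun t => A t i j) (-Y i j) 0)
    (hB : ∀ i j, HasDerivAt (fun t => B t i j) (Y j i) 0) (P : Poly n) :
    ∀ φ : Poly n →ₗ[ℂ] ℂ, HasDerivAt (fun t => φ (subst (A t) (B t) P)) (φ (dL Y P)) 0 := by
  induction P using MvPolynomial.induction_on with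
  | C a =>
    intro φ
    simpa [dL_eq_dLDerivation, subst] using hasDerivAt_const (0 : ℝ) (φ (C a))
  | add p q hp hq =>
    intro φ
    simp only [map_add, dL_eq_dLDerivation] at hp hq ⊢
    exact (hp φ).add (hq φ)
  | mul_X p i hp =>
    intro φ
    have h0 : subst (A 0) (B 0) p = p := by rw [hA0, hB0, subst_one]; rfl
    rcases i with i | i
    · have h1 : ∀ t, φ (subst (A t) (B t) (p * X (Sum.inl i)))
          = ∑ j, A t i j * (φ ∘ₗ LinearMap.mulRight ℂ (hol j)) (subst (A t) (B t) p) := by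
        intro t
        rw [map_mul]
        change φ (_ * subst (A t) (B t) (hol i)) = _
        rw [subst_hol, Finset.mul_sum, map_sum]
        refine Finset.sum_congr rfl fun j _ => ?_
        rw [mul_left_comm, ← smul_eq_C_mul, map_smul]
        rfl
      simp only [h1]
      have h2 := HasDerivAt.fun_sum (u := Finset.univ) fun j _ =>
        (hA i j).mul (hp (φ ∘ₗ LinearMap.mulRight ℂ (hol j)))
      refine h2.congr_deriv ?_
      rw [dL_eq_dLDerivation _ (p * _), Derivation.leibniz]
      change _ = φ (p • dLDerivation Y (hol i) + hol i • dLDerivation Y p)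
      rw [Finset.sum_add_distrib, map_add, h0, hA0, dLDerivation_hol]
      refine congrArg₂ (· + ·) ?_ ?_
      · rw [smul_eq_mul, mul_neg, Finset.mul_sum, map_neg, map_sum, ← Finset.sum_neg_distrib]
        refine Finset.sum_congr rfl fun j _ => ?_
        rw [mul_left_comm, ← smul_eq_C_mul, map_smul, neg_mul]
        rfl
      · simp [-Fintype.sum_sum_type, Matrix.one_apply, dL_eq_dLDerivation, mul_comm]
    · have h1 : ∀ t, φ (subst (A t) (B t) (p * X (Sum.inr i)))
          = ∑ j, B t i j * (φ ∘ₗ LinearMap.mulRight ℂ (conj j)) (subst (A t) (B t) p) := by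
        intro t
        rw [map_mul]
        change φ (_ * subst (A t) (B t) (conj i)) = _
        rw [subst_conj, Finset.mul_sum, map_sum]
        refine Finset.sum_congr rfl fun j _ => ?_
        rw [mul_left_comm, ← smul_eq_C_mul, map_smul]
        rfl
      simp only [h1]
      have h2 := HasDerivAt.fun_sum (u := Finset.univ) fun j _ =>
        (hB i j).mul (hp (φ ∘ₗ LinearMap.mulRight ℂ (conj j)))
      refine h2.congr_deriv ?_
      rw [dL_eq_dLDerivation _ (p * _), Derivation.leibniz]
      change _ = φ (p • dLDerivation Y (conj i) + conj i • dLDerivation Y p)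
      rw [Finset.sum_add_distrib, map_add, h0, hB0, dLDerivation_conj]
      refine congrArg₂ (· + ·) ?_ ?_
      · rw [smul_eq_mul, Finset.mul_sum, map_sum]
        refine Finset.sum_congr rfl fun j _ => ?_
        rw [mul_left_comm, ← smul_eq_C_mul, map_smul]
        rfl
      · simp [-Fintype.sum_sum_type, Matrix.one_apply, dL_eq_dLDerivation, mul_comm]

theorem hasDerivAt_exp_smul_apply (Y : Matrix (Idx n) (Idx n) ℂ) (i j : Idx n) :
    HasDerivAt (fun t : ℝ => NormedSpace.exp (t • Y) i j) (Y i j) 0 := by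
  let _ : NormedRing (Matrix (Idx n) (Idx n) ℂ) := Matrix.linftyOpNormedRing
  let _ : NormedAlgebra ℝ (Matrix (Idx n) (Idx n) ℂ) := Matrix.linftyOpNormedAlgebra
  have hexp : HasDerivAt (fun t : ℝ => NormedSpace.exp (t • Y)) Y 0 := by
    have := hasDerivAt_exp_smul_const (𝕂 := ℝ) Y (0 : ℝ)
    rw [zero_smul, NormedSpace.exp_zero, one_mul] at this
    exact this
  exact (LinearMap.toContinuousLinearMap
    (Matrix.entryLinearMap ℝ ℂ i j)).hasFDerivAt.comp_hasDerivAt (0 : ℝ) hexp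

/-- The condition on `Y` that `exp (t Y)` be symplectic for all `t`. -/
def IsSkewForJ (Y : Matrix (Idx n) (Idx n) ℂ) : Prop :=
  Y * Matrix.J (Fin n) ℂ = -(Matrix.J (Fin n) ℂ * Yᵀ)

theorem IsSymplecticLie.isSkewForJ {Y : Matrix (Idx n) (Idx n) ℂ} (hY : IsSymplecticLie Y) :
    IsSkewForJ Y := by
  obtain ⟨A, B, C, hB, hC, rfl⟩ := hY
  simp [IsSkewForJ, Matrix.J, Matrix.fromBlocks_multiply, Matrix.fromBlocks_transpose, hB.eq, hC.eq,
    Matrix.fromBlocks_neg]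

theorem IsSkewForJ.add {Y Z : Matrix (Idx n) (Idx n) ℂ} (hY : IsSkewForJ Y) (hZ : IsSkewForJ Z) :
    IsSkewForJ (Y + Z) := by
  rw [IsSkewForJ] at *
  rw [Matrix.add_mul, hY, hZ, Matrix.transpose_add, Matrix.mul_add, neg_add]

theorem IsSkewForJ.smul {Y : Matrix (Idx n) (Idx n) ℂ} (hY : IsSkewForJ Y) (c : ℂ) :
    IsSkewForJ (c • Y) := by
  rw [IsSkewForJ] at *
  rw [Matrix.smul_mul, hY, Matrix.transpose_smul, Matrix.mul_smul, smul_neg]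

theorem IsSkewForJ.conjTranspose {Y : Matrix (Idx n) (Idx n) ℂ} (hY : IsSkewForJ Y) :
    IsSkewForJ Yᴴ := by
  have hJ : (Matrix.J (Fin n) ℂ)ᴴ = -Matrix.J (Fin n) ℂ := by
    simp [Matrix.J, Matrix.fromBlocks_conjTranspose, Matrix.fromBlocks_neg]
  have h := congrArg Matrix.conjTranspose hY
  rw [Matrix.conjTranspose_neg, Matrix.conjTranspose_mul, Matrix.conjTranspose_mul, hJ,
    Matrix.neg_mul, Matrix.mul_neg, neg_neg] at h
  have h2 : Matrix.J (Fin n) ℂ * (-(Matrix.J (Fin n) ℂ * Yᴴ)) * Matrix.J (Fin n) ℂ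
      = Matrix.J (Fin n) ℂ * (Yᵀᴴ * Matrix.J (Fin n) ℂ) * Matrix.J (Fin n) ℂ := by rw [h]
  rw [Matrix.mul_neg, ← Matrix.mul_assoc, Matrix.J_squared, Matrix.mul_assoc _ _ (Matrix.J _ _),
    Matrix.mul_assoc _ (Matrix.J _ _) (Matrix.J _ _), Matrix.J_squared] at h2
  rw [IsSkewForJ]
  have h3 : Yᴴᵀ = Yᵀᴴ := rfl
  rw [h3]
  simpa using h2

/-- The condition reads J ᵗY J⁻¹ = -Y, which exponentiates to J ᵗ(exp Y) J⁻¹ = (exp Y)⁻¹. -/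
theorem exp_mem_symplecticGroup {Y : Matrix (Idx n) (Idx n) ℂ} (hY : IsSkewForJ Y) :
    NormedSpace.exp Y ∈ Matrix.symplecticGroup (Fin n) ℂ := by
  have hJ : IsUnit (Matrix.J (Fin n) ℂ) :=
    (Matrix.isUnit_iff_isUnit_det _).mpr (Matrix.isUnit_det_J (Fin n) ℂ)
  have hJd := Matrix.isUnit_det_J (Fin n) ℂ
  have h1 : Matrix.J (Fin n) ℂ * Yᵀ * (Matrix.J (Fin n) ℂ)⁻¹ = -Y := by
    rw [← neg_eq_iff_eq_neg.mpr hY, Matrix.neg_mul, Matrix.mul_nonsing_inv_cancel_right _ _ hJd]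
  have h2 := Matrix.exp_conj (Matrix.J (Fin n) ℂ) Yᵀ hJ
  rw [h1, Matrix.exp_transpose, Matrix.exp_neg] at h2
  rw [SymplecticGroup.mem_iff, Matrix.mul_assoc, ← Matrix.nonsing_inv_mul_cancel_right
    (Matrix.J (Fin n) ℂ) (Matrix.J (Fin n) ℂ * (NormedSpace.exp Y)ᵀ) hJd, ← h2,
    Matrix.mul_nonsing_inv_cancel_left]
  exact (Matrix.isUnit_iff_isUnit_det _).mp (Matrix.isUnit_exp Y)

theorem exp_mem_unitaryGroup {Y : Matrix (Idx n) (Idx n) ℂ} (hY : Yᴴ = -Y) :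
    NormedSpace.exp Y ∈ Matrix.unitaryGroup (Idx n) ℂ := by
  rw [Matrix.mem_unitaryGroup_iff, Matrix.star_eq_conjTranspose, ← Matrix.exp_conjTranspose, hY,
    Matrix.exp_neg]
  exact Matrix.mul_nonsing_inv _ ((Matrix.isUnit_iff_isUnit_det _).mp (Matrix.isUnit_exp Y))

/-- If `dL Y P` were outside `W`, some functional vanishing on `W` would not vanish on it. Along the
orbit exp(tY)·P, which stays in `W`, this functional is identically 0, hence so is its derivative at
0. -/
theorem dL_mem_of_skewAdjoint {W : Submodule ℂ (Poly n)}
    (hW : ∀ u : Sp n, ∀ P ∈ W, leftAction n u P ∈ W) {Y : Matrix (Idx n) (Idx n) ℂ}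
    (hJ : IsSkewForJ Y) (hY : Yᴴ = -Y) {P : Poly n} (hP : P ∈ W) : dL Y P ∈ W := by
  by_contra hnot
  obtain ⟨φ, hφ, hφW⟩ := Submodule.exists_le_ker_of_notMem hnot
  have hYt : ∀ t : ℝ, (t • Y)ᴴ = -(t • Y) := fun t => by
    rw [Matrix.conjTranspose_smul, hY, smul_neg, star_trivial]
  have hJt : ∀ t : ℝ, IsSkewForJ (t • Y) := fun t => by
    have := hJ.smul (t : ℂ)
    rwa [Complex.coe_smul] at this
  let u : ℝ → Sp n := fun t =>
    ⟨⟨NormedSpace.exp (t • Y), exp_mem_unitaryGroup (hYt t)⟩, exp_mem_symplecticGroup (hJt t)⟩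
  have hu : ∀ t, Sp.mat (u t)⁻¹ = NormedSpace.exp (t • -Y) := by
    intro t
    have h1 : Sp.mat (u t)⁻¹ = (NormedSpace.exp (t • Y))ᴴ := rfl
    rw [h1, ← Matrix.exp_conjTranspose, hYt, smul_neg]
  have hd := hasDerivAt_apply_subst (A := fun t => Sp.mat (u t)⁻¹) (B := fun t => (Sp.mat (u t))ᵀ)
    (Y := Y) (by rw [hu]; simp) (by
      have : Sp.mat (u 0) = NormedSpace.exp ((0 : ℝ) • Y) := rfl
      rw [this]; simp)
    (fun i j => by
      simp only [hu]
      exact hasDerivAt_exp_smul_apply (-Y) i j)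
    (fun i j => hasDerivAt_exp_smul_apply Y j i) P φ
  have h0 : ∀ t, φ (subst (Sp.mat (u t)⁻¹) (Sp.mat (u t))ᵀ P) = 0 := fun t =>
    hφW (hW (u t) P hP)
  simp only [h0] at hd
  exact hφ (hd.unique (hasDerivAt_const (0 : ℝ) (0 : ℂ)))

/-- A subspace invariant under `Sp(n)` is invariant under the complexified infinitesimal action. -/
theorem dL_mem_of_leftAction {W : Submodule ℂ (Poly n)}
    (hW : ∀ u : Sp n, ∀ P ∈ W, leftAction n u P ∈ W) {Y : Matrix (Idx n) (Idx n) ℂ}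
    (hJ : IsSkewForJ Y) {P : Poly n} (hP : P ∈ W) : dL Y P ∈ W := by
  -- Y is a complex combination of Y - Yᴴ and i(Y + Yᴴ), both skew-adjoint, hence in the Lie algebra
  -- of the compact group.
  have h1 : dL (Y + (-1 : ℂ) • Yᴴ) P ∈ W := by
    refine dL_mem_of_skewAdjoint hW (hJ.add (hJ.conjTranspose.smul _)) ?_ hP
    simp
  have h2 : dL (Complex.I • (Y + Yᴴ)) P ∈ W := by
    refine dL_mem_of_skewAdjoint hW ((hJ.add hJ.conjTranspose).smul _) ?_ hP
    simp [Matrix.conjTranspose_smul, add_comm]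
  have h3 : Y = (1 / 2 : ℂ) • (Y + (-1 : ℂ) • Yᴴ) + (-Complex.I / 2) • (Complex.I • (Y + Yᴴ)) := by
    have : -Complex.I / 2 * Complex.I = 1 / 2 := by
      linear_combination (-1 / 2 : ℂ) * Complex.I_mul_I
    rw [smul_smul, this]
    module
  rw [h3, dL_matrix_add, dL_matrix_smul, dL_matrix_smul]
  exact add_mem (W.smul_mem _ h1) (W.smul_mem _ h2)

/-! ### Singular polynomials are determined on a four-dimensional slice -/

/-- `P` is annihilated by all positive root vectors. -/
def IsSingular (P : Poly n) : Prop :=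
  ∀ Y : Matrix (Idx n) (Idx n) ℂ, IsPositiveRootVector Y → dL Y P = 0

theorem eval_subst (A B : Matrix (Idx n) (Idx n) ℂ) (x y : Idx n → ℂ) (P : Poly n) :
    eval (Sum.elim x y) (subst A B P) = eval (Sum.elim (A *ᵥ x) (B *ᵥ y)) P := by
  have h : (aeval (Sum.elim x y) : Poly n →ₐ[ℂ] ℂ).comp (subst A B)
      = aeval (Sum.elim (A *ᵥ x) (B *ᵥ y)) := by
    apply MvPolynomial.algHom_ext
    rintro (i | i) <;> simp [subst, hol, conj, Matrix.mulVec, dotProduct]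
  exact DFunLike.congr_fun h P

/-- Since Y² = 0, the matrices 1 - tY form a one-parameter group. The group law carries the
vanishing of the derivative at t = 0 to every t, so the value is constant and t = 0, 1 can be
compared. -/
theorem eval_unipotent {Y : Matrix (Idx n) (Idx n) ℂ} (hY : Y * Y = 0) {P : Poly n}
    (hP : dL Y P = 0) (x y : Idx n → ℂ) :
    eval (Sum.elim (x - Y *ᵥ x) (y + Yᵀ *ᵥ y)) P = eval (Sum.elim x y) P := by
  let U : ℝ → Poly n →ₐ[ℂ] Poly n := fun t => subst (1 - t • Y) (1 + t • Yᵀ)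
  have hU : ∀ s t P, U s (U t P) = U (s + t) P := by
    intro s t P
    have hYT : Yᵀ * Yᵀ = 0 := by rw [← Matrix.transpose_mul, hY, Matrix.transpose_zero]
    have h1 : (1 - t • Y) * (1 - s • Y) = 1 - (s + t) • Y := by
      simp only [Matrix.mul_sub, Matrix.sub_mul, Matrix.smul_mul, Matrix.mul_smul, hY, smul_zero,
        Matrix.mul_one, Matrix.one_mul, add_smul, sub_zero]
      abel
    have h2 : (1 + t • Yᵀ) * (1 + s • Yᵀ) = 1 + (s + t) • Yᵀ := by
      simp only [Matrix.mul_add, Matrix.add_mul, Matrix.smul_mul, Matrix.mul_smul, hYT, smul_zero,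
        Matrix.mul_one, Matrix.one_mul, add_smul, add_zero]
      abel
    simp only [U, subst_subst, h1, h2]
  let φ : Poly n →ₗ[ℂ] ℂ := (aeval (Sum.elim x y) : Poly n →ₐ[ℂ] ℂ).toLinearMap
  have hA : ∀ a b : ℂ, HasDerivAt (fun t : ℝ => a - (t : ℂ) * b) (-b) 0 := fun a b => by
    simpa using (((hasDerivAt_id (0 : ℝ)).ofReal_comp).mul_const b).const_sub a
  have hd : ∀ s : ℝ, HasDerivAt (fun t => φ (U t P)) 0 s := by
    intro s
    have h1 := hasDerivAt_apply_subst (A := fun t : ℝ => 1 - t • Y) (B := fun t : ℝ => 1 + t • Yᵀ)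
      (Y := Y) (by simp) (by simp)
      (fun i j => by simpa using hA ((1 : Matrix (Idx n) (Idx n) ℂ) i j) (Y i j))
      (fun i j => by simpa using hA ((1 : Matrix (Idx n) (Idx n) ℂ) i j) (-Y j i)) P
      (φ ∘ₗ (U s).toLinearMap)
    rw [hP, map_zero] at h1
    have h2 : HasDerivAt (fun t : ℝ => φ (U (s + t) P)) 0 0 := by
      refine h1.congr_of_eventuallyEq (Filter.Eventually.of_forall fun t => ?_)
      change φ (U (s + t) P) = φ (U s (U t P))
      rw [hU]
    rw [← sub_self s] at h2
    simpa only [add_sub_cancel] using h2.comp_sub_const s s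
  have h1 : φ (U 1 P) = φ (U 0 P) :=
    is_const_of_deriv_eq_zero (fun s => (hd s).differentiableAt) (fun s => (hd s).deriv) 1 0
  have h2 : ∀ t, φ (U t P) = eval (Sum.elim x y) (U t P) := fun t => rfl
  rw [h2, h2] at h1
  simp only [U, eval_subst, one_smul, zero_smul, sub_zero, add_zero, Matrix.one_mulVec,
    Matrix.sub_mulVec, Matrix.add_mulVec] at h1
  exact h1

/-- Two points are related if no singular polynomial separates them. -/
def Related (v v' : Idx n ⊕ Idx n → ℂ) : Prop :=
  ∀ P : Poly n, IsSingular P → eval v P = eval v' P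

theorem Related.trans {v v' v'' : Idx n ⊕ Idx n → ℂ} (h : Related v v') (h' : Related v' v'') :
    Related v v'' := fun P hP => (h P hP).trans (h' P hP)

theorem related_root {Y : Matrix (Idx n) (Idx n) ℂ} (hY : IsPositiveRootVector Y)
    (x y : Idx n → ℂ) (c : ℂ) :
    Related (Sum.elim x y) (Sum.elim (x - c • (Y *ᵥ x)) (y + c • (Yᵀ *ᵥ y))) := by
  intro P hP
  have hsq : Y * Y = 0 := by
    cases hY with
    | sub r s h =>
      simp [E, Matrix.mul_sub, Matrix.sub_mul, Matrix.single_mul_single_of_ne, h.ne, h.ne']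
    | add r s h => simp [E, Matrix.mul_add, Matrix.add_mul, Matrix.single_mul_single_of_ne]
    | two r => simp [E, Matrix.single_mul_single_of_ne]
  have h1 := eval_unipotent (Y := c • Y) (by rw [Matrix.smul_mul, Matrix.mul_smul, hsq]; simp)
    (P := P) (by rw [dL_matrix_smul, hP Y hY, smul_zero]) x y
  rw [Matrix.transpose_smul, Matrix.smul_mulVec, Matrix.smul_mulVec] at h1
  exact h1.symm

theorem E_mulVec (i j : Idx n) (x : Idx n → ℂ) : E i j *ᵥ x = Pi.single i (x j) := by
  rw [E, Matrix.single_mulVec, one_mul]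
  rfl

theorem E_transpose (i j : Idx n) : (E i j)ᵀ = E j i := Matrix.transpose_single _ _ _

theorem related_sub {r s : Fin n} (h : r < s) (x y : Idx n → ℂ) (c : ℂ) :
    Related (Sum.elim x y) (Sum.elim
      (x - c • (Pi.single (.inl r) (x (.inl s)) - Pi.single (.inr s) (x (.inr r))))
      (y + c • (Pi.single (.inl s) (y (.inl r)) - Pi.single (.inr r) (y (.inr s))))) := by
  have := related_root (.sub r s h) x y c
  simpa only [Matrix.transpose_sub, E_transpose, Matrix.sub_mulVec, E_mulVec] using this

theorem related_add {r s : Fin n} (h : r < s) (x y : Idx n → ℂ) (c : ℂ) :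
    Related (Sum.elim x y) (Sum.elim
      (x - c • (Pi.single (.inl r) (x (.inr s)) + Pi.single (.inl s) (x (.inr r))))
      (y + c • (Pi.single (.inr s) (y (.inl r)) + Pi.single (.inr r) (y (.inl s))))) := by
  have := related_root (.add r s h) x y c
  simpa only [Matrix.transpose_add, E_transpose, Matrix.add_mulVec, E_mulVec] using this

theorem related_two (r : Fin n) (x y : Idx n → ℂ) (c : ℂ) :
    Related (Sum.elim x y) (Sum.elim
      (x - c • Pi.single (.inl r) (x (.inr r)))
      (y + c • Pi.single (.inr r) (y (.inl r)))) := by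
  have := related_root (.two r) x y c
  simpa only [E_transpose, E_mulVec] using this

theorem isSingular_minor (hn : 2 ≤ n) : IsSingular (minor hn) :=
  fun Y hY => by rw [dL_eq_dLDerivation, (dLDerivation_positiveRoot hn hY).2.2]

/-- Elimination with pivot w₁: for each index a other than 1, the root L₁ - L_a clears w_a and then
L₁ + L_a clears z_a; finally 2L₁ clears z₁. -/
theorem exists_related_hol (hn : 2 ≤ n) (x y : Idx n → ℂ)
    (hx : x (.inr ⟨0, Nat.zero_lt_of_lt hn⟩) ≠ 0) :
    ∃ x' y', Related (Sum.elim x y) (Sum.elim x' y') ∧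
      ∀ i, i ≠ .inr ⟨0, Nat.zero_lt_of_lt hn⟩ → x' i = 0 := by
  have key : ∀ s : Finset (Fin n), ⟨0, Nat.zero_lt_of_lt hn⟩ ∉ s → ∃ x' y',
      Related (Sum.elim x y) (Sum.elim x' y') ∧ x' (.inr ⟨0, Nat.zero_lt_of_lt hn⟩) ≠ 0 ∧
      ∀ r ∈ s, x' (.inl r) = 0 ∧ x' (.inr r) = 0 := by
    intro s
    induction s using Finset.induction_on with
    | empty => exact fun _ => ⟨x, y, fun _ _ => rfl, hx, by simp⟩
    | insert a s ha ih =>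
      intro h0
      obtain ⟨x₁, y₁, hrel, hx₁, hs⟩ := ih fun h => h0 (Finset.mem_insert_of_mem h)
      have ha0 : a ≠ ⟨0, Nat.zero_lt_of_lt hn⟩ := fun h => h0 (h ▸ Finset.mem_insert_self _ _)
      have hlt : (⟨0, Nat.zero_lt_of_lt hn⟩ : Fin n) < a :=
        Fin.lt_def.mpr (Nat.pos_of_ne_zero fun h => ha0 (Fin.ext h))
      have h1 := related_sub hlt x₁ y₁ (-x₁ (.inr a) / x₁ (.inr ⟨0, Nat.zero_lt_of_lt hn⟩))
      generalize hx₂ : x₁ - _ = x₂ at h1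
      generalize y₁ + _ = y₂ at h1
      have h2 := related_add hlt x₂ y₂ (x₂ (.inl a) / x₂ (.inr ⟨0, Nat.zero_lt_of_lt hn⟩))
      generalize hx₃ : x₂ - _ = x₃ at h2
      generalize y₂ + _ = y₃ at h2
      have e2 : x₂ (.inr ⟨0, Nat.zero_lt_of_lt hn⟩) = x₁ (.inr ⟨0, Nat.zero_lt_of_lt hn⟩) := by
        rw [← hx₂]; simp [ha0.symm]
      have e2a : x₂ (.inr a) = 0 := by
        rw [← hx₂]; simp; field_simp; ring
      have e3 : x₃ (.inr ⟨0, Nat.zero_lt_of_lt hn⟩) = x₂ (.inr ⟨0, Nat.zero_lt_of_lt hn⟩) := by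
        rw [← hx₃]; simp
      have e3a : x₃ (.inr a) = 0 := by
        rw [← hx₃]; simp [e2a]
      have e3b : x₃ (.inl a) = 0 := by
        rw [← e2] at hx₁
        rw [← hx₃]; simp [ha0]; field_simp; ring
      refine ⟨x₃, y₃, (hrel.trans h1).trans h2, by rwa [e3, e2], fun r hr => ?_⟩
      rcases Finset.mem_insert.mp hr with rfl | hr
      · exact ⟨e3b, e3a⟩
      · have hra : r ≠ a := fun h => ha (h ▸ hr)
        have hr0 : r ≠ ⟨0, Nat.zero_lt_of_lt hn⟩ := fun h => h0 (h ▸ Finset.mem_insert_of_mem hr)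
        rw [← hx₃, ← hx₂]
        simp [Pi.single_apply, hra, hr0, hs r hr]
  obtain ⟨x₁, y₁, hrel, hx₁, hs⟩ := key (Finset.univ.erase ⟨0, Nat.zero_lt_of_lt hn⟩) (by simp)
  have h1 := related_two ⟨0, Nat.zero_lt_of_lt hn⟩ x₁ y₁
    (x₁ (.inl ⟨0, Nat.zero_lt_of_lt hn⟩) / x₁ (.inr ⟨0, Nat.zero_lt_of_lt hn⟩))
  refine ⟨_, _, hrel.trans h1, ?_⟩
  rintro (r | r) hr
  · by_cases h : r = ⟨0, Nat.zero_lt_of_lt hn⟩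
    · rw [h]; simp; field_simp; ring
    · simp [h, hs r (by simp [h])]
  · have h : r ≠ ⟨0, Nat.zero_lt_of_lt hn⟩ := fun h => hr (by rw [h])
    simp [hs r (by simp [h])]

/-- Elimination with pivot z̄₂: L₂ - L_a clears z̄_a, L₂ + L_a clears w̄_a, and 2L₂ clears w̄₂.
These moves fix `x`, whose only possibly nonzero coordinate is w₁. -/
theorem exists_related_conj (hn : 2 ≤ n) (x y : Idx n → ℂ)
    (hx : ∀ i, i ≠ .inr ⟨0, Nat.zero_lt_of_lt hn⟩ → x i = 0) (hy : y (.inl ⟨1, hn⟩) ≠ 0) :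
    ∃ y', Related (Sum.elim x y) (Sum.elim x y') ∧
      ∀ i, i ≠ .inl ⟨0, Nat.zero_lt_of_lt hn⟩ → i ≠ .inl ⟨1, hn⟩ →
        i ≠ .inr ⟨0, Nat.zero_lt_of_lt hn⟩ → y' i = 0 := by
  have h01 : (⟨0, Nat.zero_lt_of_lt hn⟩ : Fin n) ≠ ⟨1, hn⟩ := by simp
  have key : ∀ s : Finset (Fin n), ⟨0, Nat.zero_lt_of_lt hn⟩ ∉ s → ⟨1, hn⟩ ∉ s → ∃ y',
      Related (Sum.elim x y) (Sum.elim x y') ∧ y' (.inl ⟨1, hn⟩) ≠ 0 ∧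
      ∀ r ∈ s, y' (.inl r) = 0 ∧ y' (.inr r) = 0 := by
    intro s
    induction s using Finset.induction_on with
    | empty => exact fun _ _ => ⟨y, fun _ _ => rfl, hy, by simp⟩
    | insert a s ha ih =>
      intro h0 h1
      obtain ⟨y₁, hrel, hy₁, hs⟩ := ih (fun h => h0 (Finset.mem_insert_of_mem h))
        (fun h => h1 (Finset.mem_insert_of_mem h))
      have ha0 : a ≠ ⟨0, Nat.zero_lt_of_lt hn⟩ := fun h => h0 (h ▸ Finset.mem_insert_self _ _)
      have ha1 : a ≠ ⟨1, hn⟩ := fun h => h1 (h ▸ Finset.mem_insert_self _ _)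
      have hlt : (⟨1, hn⟩ : Fin n) < a := by
        have h2 : a.1 ≠ 0 := fun h => ha0 (Fin.ext h)
        have h3 : a.1 ≠ 1 := fun h => ha1 (Fin.ext h)
        exact Fin.lt_def.mpr (by simp; omega)
      have z1 : x (.inr ⟨1, hn⟩) = 0 := hx _ (by simp)
      have z2 : x (.inr a) = 0 := hx _ (by simp [ha0])
      have z3 : ∀ r, x (.inl r) = 0 := fun r => hx _ (by simp)
      have r1 := related_sub hlt x y₁ (-y₁ (.inl a) / y₁ (.inl ⟨1, hn⟩))
      rw [z1, z3, Pi.single_zero, Pi.single_zero, sub_zero, smul_zero, sub_zero] at r1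
      generalize hy₂ : y₁ + _ = y₂ at r1
      have r2 := related_add hlt x y₂ (-y₂ (.inr a) / y₂ (.inl ⟨1, hn⟩))
      rw [z1, z2, Pi.single_zero, Pi.single_zero, add_zero, smul_zero, sub_zero] at r2
      generalize hy₃ : y₂ + _ = y₃ at r2
      have e2 : y₂ (.inl ⟨1, hn⟩) = y₁ (.inl ⟨1, hn⟩) := by
        rw [← hy₂]; simp [ha1.symm]
      have e2a : y₂ (.inl a) = 0 := by
        rw [← hy₂]; simp; field_simp; ring
      have e3 : y₃ (.inl ⟨1, hn⟩) = y₂ (.inl ⟨1, hn⟩) := by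
        rw [← hy₃]; simp
      have e3a : y₃ (.inl a) = 0 := by
        rw [← hy₃]; simp [e2a]
      have e3b : y₃ (.inr a) = 0 := by
        rw [← e2] at hy₁
        rw [← hy₃]; simp [ha1]; field_simp; ring
      refine ⟨y₃, (hrel.trans r1).trans r2, by rwa [e3, e2], fun r hr => ?_⟩
      rcases Finset.mem_insert.mp hr with rfl | hr
      · exact ⟨e3a, e3b⟩
      · have hra : r ≠ a := fun h => ha (h ▸ hr)
        have hr1 : r ≠ ⟨1, hn⟩ := fun h => h1 (h ▸ Finset.mem_insert_of_mem hr)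
        rw [← hy₃, ← hy₂]
        simp [Pi.single_apply, hra, hr1, hs r hr]
  obtain ⟨y₁, hrel, hy₁, hs⟩ :=
    key ((Finset.univ.erase ⟨0, Nat.zero_lt_of_lt hn⟩).erase ⟨1, hn⟩) (by simp) (by simp)
  have r1 := related_two ⟨1, hn⟩ x y₁
    (-y₁ (.inr ⟨1, hn⟩) / y₁ (.inl ⟨1, hn⟩))
  rw [hx (.inr ⟨1, hn⟩) (by simp), Pi.single_zero, smul_zero, sub_zero] at r1
  refine ⟨_, hrel.trans r1, ?_⟩
  rintro (r | r) h0 h1 h2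
  · have h0' : r ≠ ⟨0, Nat.zero_lt_of_lt hn⟩ := fun h => h0 (by rw [h])
    have h1' : r ≠ ⟨1, hn⟩ := fun h => h1 (by rw [h])
    simp [hs r (by simp [h0', h1'])]
  · have h2' : r ≠ ⟨0, Nat.zero_lt_of_lt hn⟩ := fun h => h2 (by rw [h])
    by_cases h : r = ⟨1, hn⟩
    · rw [h]; simp; field_simp; ring
    · simp [h, hs r (by simp [h2', h])]

/-- The coordinates that are not constrained to vanish on the slice. -/
def sliceIndices (hn : 2 ≤ n) : Finset (Idx n ⊕ Idx n) :=
  {.inl (.inr ⟨0, Nat.zero_lt_of_lt hn⟩), .inr (.inl ⟨0, Nat.zero_lt_of_lt hn⟩),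
    .inr (.inl ⟨1, hn⟩), .inr (.inr ⟨0, Nat.zero_lt_of_lt hn⟩)}

theorem IsSingular.eq_zero_of_eval_slice (hn : 2 ≤ n) {P : Poly n} (hP : IsSingular P)
    (h : ∀ v : Idx n ⊕ Idx n → ℂ, (∀ i, i ∉ sliceIndices hn → v i = 0) → eval v P = 0) :
    P = 0 := by
  -- The slice is reached only from points where w₁ and the minor do not vanish; multiplying by both
  -- makes the other points harmless.
  suffices h0 : hol (.inr ⟨0, Nat.zero_lt_of_lt hn⟩) * minor hn * P = 0 from
    (mul_eq_zero.mp h0).resolve_left (mul_ne_zero (X_ne_zero _) (minor_ne_zero hn))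
  refine MvPolynomial.funext fun v => ?_
  rw [map_mul, map_mul, map_zero]
  by_cases hw : eval v (hol (.inr ⟨0, Nat.zero_lt_of_lt hn⟩)) = 0
  · rw [hw, zero_mul, zero_mul]
  by_cases hm : eval v (minor hn) = 0
  · rw [hm, mul_zero, zero_mul]
  obtain ⟨x, y, rfl⟩ : ∃ x y, v = Sum.elim x y := ⟨_, _, (Sum.elim_comp_inl_inr v).symm⟩
  obtain ⟨x₁, y₁, h1, hx₁⟩ := exists_related_hol hn x y (by simpa [hol] using hw)
  -- The minor is itself singular, so it keeps its value along the first move. At the new point it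
  -- equals -w₁ z̄₂, whence z̄₂ ≠ 0.
  rw [h1 _ (isSingular_minor hn)] at hm
  obtain ⟨y₂, h2, hy₂⟩ := exists_related_conj hn x₁ y₁ hx₁ (by
    intro h3
    apply hm
    simp [minor, hol, conj, h3, hx₁ (.inr ⟨1, hn⟩) (by simp)])
  rw [(h1.trans h2) P hP, h, mul_zero]
  rintro (i | i) hi
  · exact hx₁ i fun h3 => hi (by simp [sliceIndices, h3])
  · exact hy₂ i (fun h3 => hi (by simp [sliceIndices, h3]))
      (fun h3 => hi (by simp [sliceIndices, h3])) (fun h3 => hi (by simp [sliceIndices, h3]))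

theorem IsSingular.exists_mem_support (hn : 2 ≤ n) {P : Poly n} (hP : IsSingular P) (h0 : P ≠ 0) :
    ∃ m ∈ P.support, m.support ⊆ sliceIndices hn := by
  by_contra! h
  refine h0 (hP.eq_zero_of_eval_slice hn fun v hv => ?_)
  rw [eval_eq]
  refine Finset.sum_eq_zero fun m hm => ?_
  obtain ⟨i, hi, hi'⟩ := Finset.not_subset.mp (h m hm)
  rw [Finset.prod_eq_zero hi, mul_zero]
  rw [hv i hi', zero_pow (Finsupp.mem_support_iff.mp hi)]

/-! ### Weights and multiplicity one -/

/-- A regular dominant element of the Cartan subalgebra. -/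
def regularWeight (n : ℕ) (r : Fin n) : ℂ :=
  ((n : ℂ) - (r : ℕ)) + if (r : ℕ) = 0 then Complex.I else 0

/-- The diagonal matrix of `regularWeight`. -/
def regularElement (n : ℕ) : Matrix (Idx n) (Idx n) ℂ :=
  Matrix.diagonal (Sum.elim (regularWeight n) (-regularWeight n))

/-- The weight of `hwPoly` with respect to `regularElement`. -/
noncomputable def regularEigenvalue (n : ℕ) (k γ : ℤ) : ℂ :=
  ((k : ℂ) - γ) * (n + Complex.I) + γ * (n - 1)

/-- The summand i in the first entry of `regularWeight` makes the imaginary part equal to k - γ. The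
real part then gives γ, because n ≠ 1. -/
theorem regularEigenvalue_injective (hn : 2 ≤ n) {k γ k' γ' : ℤ}
    (h : regularEigenvalue n k γ = regularEigenvalue n k' γ') : k = k' ∧ γ = γ' := by
  have him : ((k - γ : ℤ) : ℝ) = ((k' - γ' : ℤ) : ℝ) := by
    have := congrArg Complex.im h
    simpa [regularEigenvalue] using this
  have hre : ((k - γ : ℤ) : ℝ) * n + γ * (n - 1) = ((k' - γ' : ℤ) : ℝ) * n + γ' * (n - 1) := by
    have := congrArg Complex.re h
    simpa [regularEigenvalue] using this
  rw [him, add_right_inj] at hre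
  have hn' : (n : ℝ) - 1 ≠ 0 := by
    have : (2 : ℝ) ≤ n := by exact_mod_cast hn
    linarith
  have h1 : γ = γ' := by exact_mod_cast mul_right_cancel₀ hn' hre
  have h2 : k - γ = k' - γ' := by exact_mod_cast him
  exact ⟨by omega, h1⟩

theorem dL_regularElement_hwPoly (hn : 2 ≤ n) {α β γ : ℕ} (hα : γ ≤ α) (hβ : γ ≤ β) :
    dL (regularElement n) (hwPoly hn α β γ)
      = regularEigenvalue n (α + β) γ • hwPoly hn α β γ := by
  rw [regularElement, dL_diagonal_hwPoly hn _ hα hβ]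
  simp [regularWeight, regularEigenvalue]

/-- The exponent of the monomial `w₁^p z̄₁^a z̄₂^b w̄₁^c`. -/
noncomputable def sliceExponent (hn : 2 ≤ n) (p a b c : ℕ) : Idx n ⊕ Idx n →₀ ℕ :=
  Finsupp.single (.inl (.inr ⟨0, Nat.zero_lt_of_lt hn⟩)) p
    + Finsupp.single (.inr (.inl ⟨0, Nat.zero_lt_of_lt hn⟩)) a
    + Finsupp.single (.inr (.inl ⟨1, hn⟩)) b
    + Finsupp.single (.inr (.inr ⟨0, Nat.zero_lt_of_lt hn⟩)) c

theorem exists_eq_sliceExponent (hn : 2 ≤ n) {m : Idx n ⊕ Idx n →₀ ℕ}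
    (hm : m.support ⊆ sliceIndices hn) : ∃ p a b c, m = sliceExponent hn p a b c := by
  refine ⟨m (.inl (.inr ⟨0, Nat.zero_lt_of_lt hn⟩)), m (.inr (.inl ⟨0, Nat.zero_lt_of_lt hn⟩)),
    m (.inr (.inl ⟨1, hn⟩)), m (.inr (.inr ⟨0, Nat.zero_lt_of_lt hn⟩)), ?_⟩
  ext i
  by_cases hi : i ∈ sliceIndices hn
  · simp only [sliceIndices, Finset.mem_insert, Finset.mem_singleton] at hi
    rcases hi with rfl | rfl | rfl | rfl <;> simp [sliceExponent]
  · rw [Finsupp.notMem_support_iff.mp fun h => hi (hm h)]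
    simp only [sliceIndices, Finset.mem_insert, Finset.mem_singleton, not_or] at hi
    obtain ⟨h1, h2, h3, h4⟩ := hi
    simp [sliceExponent, Ne.symm h1, Ne.symm h2, Ne.symm h3, Ne.symm h4]

/-- Singular polynomials that are bihomogeneous and eigenvectors of `regularElement`. -/
structure IsSingularVector (α β : ℕ) (μ : ℂ) (P : Poly n) : Prop where
  singular : IsSingular P
  hol_homogeneous : IsWeightedHomogeneous (holWeight n) P α
  conj_homogeneous : IsWeightedHomogeneous (conjWeight n) P β
  eigen : dL (regularElement n) P = μ • P

/-- Among the slice variables only w₁ is holomorphic, so its exponent is α. The monomial has weight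
(α + a - c)L₁ + bL₂. -/
theorem IsSingularVector.exists_coeff_ne_zero (hn : 2 ≤ n) {α β : ℕ} {μ : ℂ} {P : Poly n}
    (hP : IsSingularVector α β μ P) (h0 : P ≠ 0) : ∃ a b c : ℕ, a + b + c = β ∧
      μ = regularEigenvalue n (α + a + b - c) b ∧ coeff (sliceExponent hn α a b c) P ≠ 0 := by
  obtain ⟨m, hm, hms⟩ := hP.singular.exists_mem_support hn h0
  obtain ⟨p, a, b, c, rfl⟩ := exists_eq_sliceExponent hn hms
  have hc := mem_support_iff.mp hm
  have h1 := hP.hol_homogeneous hc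
  have h2 := hP.conj_homogeneous hc
  simp only [sliceExponent, map_add, Finsupp.weight_single, holWeight, conjWeight, Sum.elim_inl,
    Sum.elim_inr, smul_eq_mul, mul_one, mul_zero, add_zero, zero_add] at h1 h2
  subst h1
  refine ⟨a, b, c, h2, ?_, hc⟩
  have h3 := congrArg (coeff (sliceExponent hn p a b c)) hP.eigen
  rw [regularElement, dL_diagonal, coeff_diagonalDerivation, coeff_smul, smul_eq_mul] at h3
  rw [← mul_right_cancel₀ hc h3, sliceExponent]
  repeat rw [Finsupp.sum_add_index' (by simp) (by intros; push_cast; ring)]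
  simp [Finsupp.sum_single_index, regularWeight, regularEigenvalue]
  ring

theorem IsSingularVector.sub_smul {α β : ℕ} {μ : ℂ} {P Q : Poly n} (hP : IsSingularVector α β μ P)
    (hQ : IsSingularVector α β μ Q) (t : ℂ) : IsSingularVector α β μ (P - t • Q) where
  singular Y hY := by
    have h1 := hP.singular Y hY
    have h2 := hQ.singular Y hY
    rw [dL_eq_dLDerivation] at h1 h2 ⊢
    rw [map_sub, (dLDerivation Y).map_smul, h1, h2, smul_zero, sub_zero]
  hol_homogeneous := Submodule.sub_mem (weightedHomogeneousSubmodule ℂ (holWeight n) α)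
    hP.hol_homogeneous (Submodule.smul_mem _ _ hQ.hol_homogeneous)
  conj_homogeneous := Submodule.sub_mem (weightedHomogeneousSubmodule ℂ (conjWeight n) β)
    hP.conj_homogeneous (Submodule.smul_mem _ _ hQ.conj_homogeneous)
  eigen := by
    have h1 := hP.eigen
    have h2 := hQ.eigen
    rw [dL_eq_dLDerivation] at h1 h2 ⊢
    rw [map_sub, (dLDerivation _).map_smul, h1, h2, smul_sub, smul_comm]

/-- The eigenvalue and the bidegree give b, a - c and a + b + c, so only one slice monomial is
possible. Cancelling its coefficient leaves a singular vector that must be zero. -/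
theorem IsSingularVector.eq_smul (hn : 2 ≤ n) {α β : ℕ} {μ : ℂ} {P Q : Poly n}
    (hP : IsSingularVector α β μ P) (hQ : IsSingularVector α β μ Q) (h0 : Q ≠ 0) :
    ∃ t : ℂ, P = t • Q := by
  obtain ⟨a, b, c, h1, h2, h3⟩ := hQ.exists_coeff_ne_zero hn h0
  refine ⟨coeff (sliceExponent hn α a b c) P / coeff (sliceExponent hn α a b c) Q, ?_⟩
  by_contra hne
  obtain ⟨a', b', c', h1', h2', h3'⟩ :=
    (hP.sub_smul hQ _).exists_coeff_ne_zero hn (sub_ne_zero.mpr hne)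
  obtain ⟨e1, e2⟩ := regularEigenvalue_injective hn (h2.symm.trans h2')
  obtain rfl : b = b' := by omega
  obtain rfl : a = a' := by omega
  obtain rfl : c = c' := by omega
  apply h3'
  rw [coeff_sub, coeff_smul, smul_eq_mul, div_mul_cancel₀ _ h3, sub_self]

/-! ### The symmetry of the two groups of variables; classification of harmonic singular vectors -/

/-- The automorphism exchanging `w_r` with `z̄_r` and `z_r` with `-w̄_r`. -/
noncomputable def swap (n : ℕ) : Poly n →ₐ[ℂ] Poly n :=
  aeval (Sum.elim (fun i => ∑ j, C (Matrix.J (Fin n) ℂ i j) * conj j)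
    (fun i => ∑ j, C (-Matrix.J (Fin n) ℂ i j) * hol j))

theorem swap_hol (i : Idx n) : swap n (hol i) = ∑ j, C (Matrix.J (Fin n) ℂ i j) * conj j :=
  aeval_X _ _

theorem swap_conj (i : Idx n) : swap n (conj i) = ∑ j, C ((-Matrix.J (Fin n) ℂ) i j) * hol j :=
  aeval_X _ _

theorem sum_C_one_mul (v : Idx n → Poly n) (i : Idx n) :
    ∑ j, C ((1 : Matrix (Idx n) (Idx n) ℂ) i j) * v j = v i := by
  simp [-Fintype.sum_sum_type, Matrix.one_apply, apply_ite C]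

theorem swap_swap (P : Poly n) : swap n (swap n P) = P := by
  suffices h : (swap n).comp (swap n) = AlgHom.id ℂ _ from DFunLike.congr_fun h P
  apply MvPolynomial.algHom_ext
  rintro (i | i)
  · change swap n (swap n (hol i)) = hol i
    simp only [swap_hol, map_sum, map_mul, algHom_C, algebraMap_eq, swap_conj]
    rw [sum_C_mul_sum_C_mul, Matrix.mul_neg, Matrix.J_squared, neg_neg, sum_C_one_mul]
  · change swap n (swap n (conj i)) = conj i
    simp only [swap_hol, map_sum, map_mul, algHom_C, algebraMap_eq, swap_conj]
    rw [sum_C_mul_sum_C_mul, Matrix.neg_mul, Matrix.J_squared, neg_neg, sum_C_one_mul]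

/-- J intertwines the two groups of variables as representations of the symplectic Lie algebra. Thus
`swap` preserves weights while exchanging the two degrees. -/
theorem dL_swap {Y : Matrix (Idx n) (Idx n) ℂ} (hY : IsSkewForJ Y) (P : Poly n) :
    dL Y (swap n P) = swap n (dL Y P) := by
  rw [dL_eq_dLDerivation, dL_eq_dLDerivation]
  refine derivation_algHom_comm _ _ ?_ P
  have hY' : -Matrix.J (Fin n) ℂ * Y = Yᵀ * Matrix.J (Fin n) ℂ := by
    have h : Matrix.J (Fin n) ℂ * (Y * Matrix.J (Fin n) ℂ) * Matrix.J (Fin n) ℂ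
      = Matrix.J (Fin n) ℂ * (-(Matrix.J (Fin n) ℂ * Yᵀ)) * Matrix.J (Fin n) ℂ :=
      congrArg (fun M => Matrix.J (Fin n) ℂ * M * Matrix.J (Fin n) ℂ) hY
    rw [Matrix.mul_neg, ← Matrix.mul_assoc, ← Matrix.mul_assoc, Matrix.J_squared, Matrix.mul_assoc,
      Matrix.J_squared] at h
    simpa using h
  rintro (i | i)
  · change dLDerivation Y (swap n (hol i)) = swap n (dLDerivation Y (hol i))
    simp only [swap_hol, dLDerivation_hol, map_neg, map_sum, map_mul, algHom_C, algebraMap_eq,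
      derivation_C_mul_self, dLDerivation_conj]
    have h1 := sum_C_mul_sum_C_mul (Matrix.J (Fin n) ℂ) Yᵀ conj i
    simp only [Matrix.transpose_apply] at h1
    rw [h1, sum_C_mul_sum_C_mul, hY]
    simp
  · change dLDerivation Y (swap n (conj i)) = swap n (dLDerivation Y (conj i))
    simp only [swap_conj, dLDerivation_hol, map_sum, map_mul, algHom_C, algebraMap_eq,
      derivation_C_mul_self, dLDerivation_conj, mul_neg, Finset.sum_neg_distrib]
    have h1 := sum_C_mul_sum_C_mul Yᵀ (-Matrix.J (Fin n) ℂ) hol i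
    simp only [Matrix.transpose_apply] at h1
    rw [h1, sum_C_mul_sum_C_mul, hY']
    simp

theorem isSymplecticLie_positiveRoot {Y : Matrix (Idx n) (Idx n) ℂ}
    (hY : IsPositiveRootVector Y) : IsSymplecticLie Y := by
  cases hY with
  | sub r s h =>
    refine ⟨Matrix.single r s 1, 0, 0, Matrix.isSymm_zero, Matrix.isSymm_zero, ?_⟩
    ext (i | i) (j | j) <;> simp [E, Matrix.single_apply, and_comm]
  | add r s h =>
    refine ⟨0, 0, Matrix.single r s 1 + Matrix.single s r 1, Matrix.isSymm_zero, ?_, ?_⟩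
    · rw [Matrix.IsSymm, Matrix.transpose_add, Matrix.transpose_single, Matrix.transpose_single,
        add_comm]
    · ext (i | i) (j | j) <;> simp [E, Matrix.single_apply]
  | two r =>
    refine ⟨0, 0, Matrix.single r r 1, Matrix.isSymm_zero, ?_, ?_⟩
    · rw [Matrix.IsSymm, Matrix.transpose_single]
    · ext (i | i) (j | j) <;> simp [E, Matrix.single_apply]

theorem isSymplecticLie_regularElement (n : ℕ) : IsSymplecticLie (regularElement n) := by
  refine ⟨Matrix.diagonal (regularWeight n), 0, 0, Matrix.isSymm_zero, Matrix.isSymm_zero, ?_⟩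
  ext (i | i) (j | j) <;> simp [regularElement, Matrix.diagonal_apply, eq_comm]

theorem IsSingularVector.swap {α β : ℕ} {μ : ℂ} {P : Poly n} (hP : IsSingularVector α β μ P) :
    IsSingularVector β α μ (swap n P) where
  singular Y hY := by
    rw [dL_swap (isSymplecticLie_positiveRoot hY).isSkewForJ, hP.singular Y hY, map_zero]
  hol_homogeneous := by
    have h := hP.conj_homogeneous
    rw [isWeightedHomogeneous_iff_diagonalDerivation] at h ⊢
    rw [derivation_algHom_intertwine _ (diagonalDerivation fun i => (conjWeight n i : ℂ)), h,
      map_smul]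
    rintro (i | i)
    all_goals simp [-Fintype.sum_sum_type, SpHarm.swap, hol, conj, diagonalDerivation,
      mkDerivation_X, conjWeight, holWeight, smul_eq_C_mul]
  conj_homogeneous := by
    have h := hP.hol_homogeneous
    rw [isWeightedHomogeneous_iff_diagonalDerivation] at h ⊢
    rw [derivation_algHom_intertwine _ (diagonalDerivation fun i => (holWeight n i : ℂ)), h,
      map_smul]
    rintro (i | i)
    all_goals simp [-Fintype.sum_sum_type, SpHarm.swap, hol, conj, diagonalDerivation,
      mkDerivation_X, conjWeight, holWeight, smul_eq_C_mul]
  eigen := by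
    rw [dL_swap (isSymplecticLie_regularElement n).isSkewForJ, hP.eigen, map_smul]

theorem isSingularVector_hwPoly (hn : 2 ≤ n) {α β γ : ℕ} (hα : γ ≤ α) (hβ : γ ≤ β) :
    IsSingularVector α β (regularEigenvalue n (α + β) γ) (hwPoly hn α β γ) where
  singular _ hY := hwPoly_annihilated hn α β γ hY
  hol_homogeneous := (mem_harmonic.mp (hwPoly_mem_harmonic hn hα hβ)).1
  conj_homogeneous := (mem_harmonic.mp (hwPoly_mem_harmonic hn hα hβ)).2.1
  eigen := dL_regularElement_hwPoly hn hα hβ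

theorem normSq_ne_zero (hn : 2 ≤ n) : normSq n ≠ 0 := by
  intro h
  have := congrArg (eval fun _ => (1 : ℂ)) h
  simp [normSq, hol, conj] at this
  omega

theorem isWeightedHomogeneous_hol_normSq (n : ℕ) :
    IsWeightedHomogeneous (holWeight n) (normSq n) 1 :=
  Submodule.sum_mem (weightedHomogeneousSubmodule ℂ (holWeight n) 1) fun i _ =>
    (isWeightedHomogeneous_X ℂ (holWeight n) (Sum.inl i)).mul
      (isWeightedHomogeneous_X ℂ (holWeight n) (Sum.inr i))

theorem isWeightedHomogeneous_conj_normSq (n : ℕ) :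
    IsWeightedHomogeneous (conjWeight n) (normSq n) 1 :=
  Submodule.sum_mem (weightedHomogeneousSubmodule ℂ (conjWeight n) 1) fun i _ =>
    (isWeightedHomogeneous_X ℂ (conjWeight n) (Sum.inl i)).mul
      (isWeightedHomogeneous_X ℂ (conjWeight n) (Sum.inr i))

theorem dL_normSq_mul (Y : Matrix (Idx n) (Idx n) ℂ) (P : Poly n) :
    dL Y (normSq n * P) = normSq n * dL Y P := by
  have h := dL_normSq Y
  rw [dL_eq_dLDerivation] at h ⊢
  rw [Derivation.leibniz, h, smul_zero, add_zero, smul_eq_mul, dL_eq_dLDerivation]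

theorem IsSingularVector.normSq_mul {α β : ℕ} {μ : ℂ} {P : Poly n}
    (hP : IsSingularVector α β μ P) : IsSingularVector (α + 1) (β + 1) μ (normSq n * P) where
  singular Y hY := by rw [dL_normSq_mul, hP.singular Y hY, mul_zero]
  hol_homogeneous := by
    rw [add_comm]
    exact (isWeightedHomogeneous_hol_normSq n).mul hP.hol_homogeneous
  conj_homogeneous := by
    rw [add_comm]
    exact (isWeightedHomogeneous_conj_normSq n).mul hP.conj_homogeneous
  eigen := by rw [dL_normSq_mul, hP.eigen, mul_smul_comm]

theorem IsSingularVector.normSq_pow_mul {α β : ℕ} {μ : ℂ} {P : Poly n}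
    (hP : IsSingularVector α β μ P) (c : ℕ) :
    IsSingularVector (α + c) (β + c) μ (normSq n ^ c * P) := by
  induction c with
  | zero => simpa using hP
  | succ c ih =>
    rw [pow_succ', mul_assoc]
    exact ih.normSq_mul

/-- By adjointness, four times the squared Fischer norm of `normSq n * P` is the product of its
Laplacian with `P`. -/
theorem eq_zero_of_laplacian_normSq_mul {P : Poly n} (h : laplacian n (normSq n * P) = 0) :
    normSq n * P = 0 := by
  have h1 := fischer_laplacian (normSq n * P) P
  rw [h, fischer_zero_left] at h1
  exact eq_zero_of_fischer_self ((mul_eq_zero.mp h1.symm).resolve_left (by norm_num))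

/-- Harmonic singular vectors are multiples of the polynomials `hwPoly`. -/
theorem IsSingularVector.exists_eq_hwPoly (hn : 2 ≤ n) {α β : ℕ} {μ : ℂ} {P : Poly n}
    (hP : IsSingularVector α β μ P) (h0 : P ≠ 0) (hL : laplacian n P = 0) :
    ∃ γ ≤ min α β, ∃ t : ℂ, P = t • hwPoly hn α β γ := by
  obtain ⟨a, b, c, h1, h2, -⟩ := hP.exists_coeff_ne_zero hn h0
  have hs0 : SpHarm.swap n P ≠ 0 := fun h => h0 (by rw [← swap_swap P, h, map_zero])
  -- The slice exponents of `swap P` give α = a' + b' + c'; equality of the weights then gives b' =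
  -- b and c' = c. Hence b ≤ α - c and b ≤ β - c, and `normSq ^ c * hwPoly` is a competitor with the
  -- same data.
  obtain ⟨a', b', c', h1', h2', -⟩ := hP.swap.exists_coeff_ne_zero hn hs0
  obtain ⟨e1, e2⟩ := regularEigenvalue_injective hn (h2.symm.trans h2')
  obtain rfl : b = b' := by omega
  obtain rfl : c = c' := by omega
  have hα : b ≤ a' + b := by omega
  have hβ : b ≤ a + b := by omega
  have hQ := (isSingularVector_hwPoly hn hα hβ).normSq_pow_mul c
  rw [h1, h1'] at hQ
  have hμ : regularEigenvalue n (↑(a' + b) + ↑(a + b)) b = μ := by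
    rw [h2]
    congr 1
    push_cast [← h1']
    ring
  rw [hμ] at hQ
  obtain ⟨t, ht⟩ := hP.eq_smul hn hQ
    (mul_ne_zero (pow_ne_zero _ (normSq_ne_zero hn)) (hwPoly_ne_zero hn _ _ _))
  rcases c with _ | c
  · refine ⟨b, by omega, t, ?_⟩
    rw [ht, pow_zero, one_mul]
    rw [← h1, ← h1', add_zero, add_zero]
  · exfalso
    rw [pow_succ', mul_assoc, ← mul_smul_comm] at ht
    rw [ht] at hL
    exact h0 (ht.trans (eq_zero_of_laplacian_normSq_mul hL))

/-! ### Dimension of the harmonic space -/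

/-- The exponents of bidegree `(α, β)`. -/
def biExponents (n α β : ℕ) : Set (Idx n ⊕ Idx n →₀ ℕ) :=
  {m | Finsupp.weight (holWeight n) m = α ∧ Finsupp.weight (conjWeight n) m = β}

/-- The space of polynomials of bidegree `(α, β)`. -/
noncomputable def bihomogeneous (n α β : ℕ) : Submodule ℂ (Poly n) :=
  restrictSupport ℂ (biExponents n α β)

theorem mem_bihomogeneous {α β : ℕ} {P : Poly n} : P ∈ bihomogeneous n α β ↔
    IsWeightedHomogeneous (holWeight n) P α ∧ IsWeightedHomogeneous (conjWeight n) P β := by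
  rw [bihomogeneous, mem_restrictSupport_iff]
  refine ⟨fun h => ⟨fun m hm => (h (mem_support_iff.mpr hm)).1,
    fun m hm => (h (mem_support_iff.mpr hm)).2⟩, fun h m hm => ?_⟩
  exact ⟨h.1 (mem_support_iff.mp hm), h.2 (mem_support_iff.mp hm)⟩

theorem harmonic_eq (α β : ℕ) :
    harmonic n α β = bihomogeneous n α β ⊓ LinearMap.ker (laplacian n) := by
  ext P
  rw [mem_harmonic, Submodule.mem_inf, mem_bihomogeneous, LinearMap.mem_ker, and_assoc]

theorem weight_holWeight (m : Idx n ⊕ Idx n →₀ ℕ) :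
    Finsupp.weight (holWeight n) m = ∑ i, m (Sum.inl i) := by
  rw [Finsupp.weight_apply, Finsupp.sum_fintype _ _ (by simp),
    Fintype.sum_sum_type (α₁ := Idx n) (α₂ := Idx n)]
  simp [holWeight, -Fintype.sum_sum_type]

theorem weight_conjWeight (m : Idx n ⊕ Idx n →₀ ℕ) :
    Finsupp.weight (conjWeight n) m = ∑ i, m (Sum.inr i) := by
  rw [Finsupp.weight_apply, Finsupp.sum_fintype _ _ (by simp),
    Fintype.sum_sum_type (α₁ := Idx n) (α₂ := Idx n)]
  simp [conjWeight, -Fintype.sum_sum_type]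

/-- Splitting an exponent into its holomorphic and conjugate parts. -/
noncomputable def biExponentsEquiv (n α β : ℕ) :
    biExponents n α β ≃ Sym (Idx n) α × Sym (Idx n) β :=
  ((Finsupp.sumFinsuppEquivProdFinsupp.subtypeEquiv (q := fun p : (Idx n →₀ ℕ) × (Idx n →₀ ℕ) =>
      p.1.sum (fun _ => id) = α ∧ p.2.sum (fun _ => id) = β) fun m => by
        change _ ∧ _ ↔ _
        rw [weight_holWeight, weight_conjWeight, Finsupp.sum_fintype _ _ (by simp),
          Finsupp.sum_fintype _ _ (by simp)]
        rfl).trans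
    (Equiv.subtypeProdEquivProd (p := fun P : Idx n →₀ ℕ => P.sum (fun _ => id) = α)
      (q := fun P : Idx n →₀ ℕ => P.sum (fun _ => id) = β))).trans
    ((Sym.equivNatSum (Idx n) α).symm.prodCongr (Sym.equivNatSum (Idx n) β).symm)

instance (α β : ℕ) : Finite (biExponents n α β) := Finite.of_equiv _ (biExponentsEquiv n α β).symm

instance (α β : ℕ) : FiniteDimensional ℂ (bihomogeneous n α β) :=
  Module.Finite.of_basis (basisRestrictSupport ℂ (biExponents n α β))

instance (α β : ℕ) : FiniteDimensional ℂ (harmonic n α β) :=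
  Submodule.finiteDimensional_of_le ((harmonic_eq α β).le.trans inf_le_left)

/-- The number of monomials of degree `a` in `2n` variables. -/
def monomialCount (n a : ℕ) : ℕ := (2 * n + a - 1).choose a

theorem finrank_bihomogeneous (n α β : ℕ) :
    Module.finrank ℂ (bihomogeneous n α β) = monomialCount n α * monomialCount n β := by
  have h := Module.finrank_eq_nat_card_basis (basisRestrictSupport ℂ (biExponents n α β))
  have hc : Fintype.card (Idx n) = 2 * n := by simp [two_mul]
  rw [Nat.card_congr (biExponentsEquiv n α β), Nat.card_eq_fintype_card, Fintype.card_prod,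
    Sym.card_sym_eq_choose, Sym.card_sym_eq_choose, hc] at h
  exact h

theorem coeff_laplacian (P : Poly n) (m : Idx n ⊕ Idx n →₀ ℕ) :
    coeff m (laplacian n P) = 4 * ∑ i : Idx n,
      coeff (m + Finsupp.single (Sum.inl i) 1 + Finsupp.single (Sum.inr i) 1) P *
        (m (Sum.inr i) + 1) * (m (Sum.inl i) + 1) := by
  simp [-Fintype.sum_sum_type, laplacian, coeff_sum, coeff_pderiv]

theorem laplacian_bihomogeneous_eq_zero {α : ℕ} {P : Poly n} (hP : P ∈ bihomogeneous n α 0) :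
    laplacian n P = 0 := by
  ext m
  rw [coeff_laplacian, coeff_zero, Finset.sum_eq_zero, mul_zero]
  intro i _
  rw [(mem_bihomogeneous.mp hP).2.coeff_eq_zero, zero_mul, zero_mul]
  simp [conjWeight, Finsupp.weight_single]

theorem laplacian_mem_bihomogeneous {α β : ℕ} {P : Poly n}
    (hP : P ∈ bihomogeneous n (α + 1) (β + 1)) : laplacian n P ∈ bihomogeneous n α β := by
  obtain ⟨h1, h2⟩ := mem_bihomogeneous.mp hP
  refine mem_bihomogeneous.mpr ⟨fun m hm => ?_, fun m hm => ?_⟩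
  · by_contra hne
    apply hm
    rw [coeff_laplacian, Finset.sum_eq_zero, mul_zero]
    intro i _
    rw [h1.coeff_eq_zero, zero_mul, zero_mul]
    simpa [holWeight, Finsupp.weight_single] using hne
  · by_contra hne
    apply hm
    rw [coeff_laplacian, Finset.sum_eq_zero, mul_zero]
    intro i _
    rw [h2.coeff_eq_zero, zero_mul, zero_mul]
    simpa [conjWeight, Finsupp.weight_single] using hne

/-- For `Q` orthogonal to the range, 0 = ⟨Δ(r²Q), Q⟩ = 4‖r²Q‖² with r² = `normSq n`, so Q = 0. -/
theorem range_laplacian (hn : 2 ≤ n) (α β : ℕ) :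
    LinearMap.range ((laplacian n).domRestrict (bihomogeneous n (α + 1) (β + 1)))
      = bihomogeneous n α β := by
  have hle : LinearMap.range ((laplacian n).domRestrict (bihomogeneous n (α + 1) (β + 1)))
      ≤ bihomogeneous n α β := by
    rintro _ ⟨P, rfl⟩
    exact laplacian_mem_bihomogeneous P.2
  by_contra hne
  obtain ⟨Q, hQ, hQ0, hQo⟩ := exists_fischer_orthogonal (lt_of_le_of_ne hle hne)
  obtain ⟨h1, h2⟩ := mem_bihomogeneous.mp hQ
  have hmem : normSq n * Q ∈ bihomogeneous n (α + 1) (β + 1) := by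
    rw [add_comm α, add_comm β]
    exact mem_bihomogeneous.mpr ⟨(isWeightedHomogeneous_hol_normSq n).mul h1,
      (isWeightedHomogeneous_conj_normSq n).mul h2⟩
  have h3 : fischer (laplacian n (normSq n * Q)) Q = 0 := hQo _ ⟨⟨_, hmem⟩, rfl⟩
  rw [fischer_laplacian] at h3
  have h4 := eq_zero_of_fischer_self ((mul_eq_zero.mp h3).resolve_left (by norm_num))
  exact mul_ne_zero (normSq_ne_zero hn) hQ0 h4

theorem finrank_harmonic_zero (n α : ℕ) :
    Module.finrank ℂ (harmonic n α 0) = monomialCount n α * monomialCount n 0 := by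
  have h : harmonic n α 0 = bihomogeneous n α 0 := by
    rw [harmonic_eq]
    exact inf_eq_left.mpr fun P hP => laplacian_bihomogeneous_eq_zero hP
  rw [h, finrank_bihomogeneous]

theorem finrank_harmonic_succ (hn : 2 ≤ n) (α β : ℕ) :
    monomialCount n α * monomialCount n β + Module.finrank ℂ (harmonic n (α + 1) (β + 1))
      = monomialCount n (α + 1) * monomialCount n (β + 1) := by
  have h := LinearMap.finrank_range_add_finrank_ker
    ((laplacian n).domRestrict (bihomogeneous n (α + 1) (β + 1)))
  rw [range_laplacian hn, finrank_bihomogeneous, finrank_bihomogeneous] at h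
  rw [← h, LinearMap.ker_domRestrict, harmonic_eq, ← Submodule.map_comap_subtype,
    Submodule.finrank_map_subtype_eq]

/-! ### Existence of highest weight vectors in invariant subspaces -/

/-- The entries of `regularWeight` have real parts n, n-1, …, 1, which are positive and decreasing,
so every positive root takes a value with positive real part. -/
theorem exists_root_positiveRoot {Y : Matrix (Idx n) (Idx n) ℂ} (hY : IsPositiveRootVector Y) :
    ∃ a : ℂ, 0 < a.re ∧ regularElement n * Y - Y * regularElement n = a • Y := by
  have key : ∀ i j : Idx n, regularElement n * E i j - E i j * regularElement n
      = (regularElement n i i - regularElement n j j) • E i j := by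
    intro i j
    ext k l
    simp only [regularElement, Matrix.sub_apply, Matrix.diagonal_mul, Matrix.mul_diagonal, E,
      Matrix.single_apply, Matrix.smul_apply, Matrix.diagonal_apply_eq, smul_eq_mul]
    split_ifs with h
    · rw [h.1, h.2]; ring
    · simp
  have hl : ∀ r : Fin n, regularElement n (.inl r) (.inl r) = regularWeight n r := fun r => by
    simp [regularElement]
  have hr : ∀ r : Fin n, regularElement n (.inr r) (.inr r) = -regularWeight n r := fun r => by
    simp [regularElement]
  have hre : ∀ r : Fin n, (regularWeight n r).re = (n : ℝ) - (r : ℕ) := fun r => by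
    simp only [regularWeight]
    split_ifs <;> simp
  have hpos : ∀ r : Fin n, 0 < (n : ℝ) - (r : ℕ) := fun r => by
    have : ((r : ℕ) : ℝ) < n := by exact_mod_cast r.2
    linarith
  cases hY with
  | sub r s h =>
    refine ⟨regularWeight n r - regularWeight n s, ?_, ?_⟩
    · have : ((r : ℕ) : ℝ) < (s : ℕ) := by exact_mod_cast h
      rw [Complex.sub_re, hre, hre]
      linarith
    · rw [Matrix.mul_sub, Matrix.sub_mul, sub_sub_sub_comm, key, key, hl, hl, hr, hr, smul_sub]
      congr 2
      ring
  | add r s h =>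
    refine ⟨regularWeight n r + regularWeight n s, ?_, ?_⟩
    · rw [Complex.add_re, hre, hre]
      linarith [hpos r, hpos s]
    · rw [Matrix.mul_add, Matrix.add_mul, add_sub_add_comm, key, key, hl, hl, hr, hr, smul_add]
      congr 2 <;> ring
  | two r =>
    refine ⟨regularWeight n r + regularWeight n r, ?_, ?_⟩
    · rw [Complex.add_re, hre]
      linarith [hpos r]
    · rw [key, hl, hr, sub_neg_eq_add]

/-- A nonzero subspace of harmonic polynomials invariant under the infinitesimal action contains
one of the highest weight vectors. -/
theorem exists_hwPoly_mem (hn : 2 ≤ n) {α β : ℕ} {W : Submodule ℂ (Poly n)}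
    (hWH : W ≤ harmonic n α β) (hW0 : W ≠ ⊥)
    (hW : ∀ Y : Matrix (Idx n) (Idx n) ℂ, IsSymplecticLie Y → ∀ P ∈ W, dL Y P ∈ W) :
    ∃ γ ≤ min α β, hwPoly hn α β γ ∈ W := by
  have : FiniteDimensional ℂ W := Submodule.finiteDimensional_of_le hWH
  have : Nontrivial W := Submodule.nontrivial_iff_ne_bot.mpr hW0
  have hreg := isSymplecticLie_regularElement n
  let D : Module.End ℂ W := (dLDerivation (regularElement n)).toLinearMap.restrict
    fun P hP => by
      have := hW _ hreg P hP
      rwa [dL_eq_dLDerivation] at this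
  -- An eigenvalue of largest real part is a highest weight: a positive root vector not killing the
  -- eigenvector would produce an eigenvalue of larger real part.
  obtain ⟨μ, hμ, hmax⟩ := Set.exists_max_image {μ : ℂ | D.HasEigenvalue μ} Complex.re
    D.finite_hasEigenvalue (Module.End.exists_eigenvalue D)
  obtain ⟨P, hP⟩ := Module.End.HasEigenvalue.exists_hasEigenvector hμ
  have hPe : dL (regularElement n) P.1 = μ • P.1 := by
    rw [dL_eq_dLDerivation]
    exact congrArg Subtype.val hP.apply_eq_smul
  have hP0 : P.1 ≠ 0 := fun h => hP.2 (Subtype.ext h)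
  have hPH := mem_harmonic.mp (hWH P.2)
  have hs : IsSingularVector α β μ P.1 := by
    refine ⟨fun Y hY => ?_, hPH.1, hPH.2.1, hPe⟩
    by_contra hne
    obtain ⟨a, ha, hYa⟩ := exists_root_positiveRoot hY
    have h1 := dL_commutator (regularElement n) Y P.1
    rw [hYa, dL_matrix_smul, hPe, dL_eq_dLDerivation Y (μ • P.1), (dLDerivation Y).map_smul,
      ← dL_eq_dLDerivation, sub_eq_iff_eq_add, ← add_smul] at h1
    have h2 : D.HasEigenvalue (a + μ) := by
      refine Module.End.hasEigenvalue_of_hasEigenvector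
        (x := ⟨dL Y P.1, hW Y (isSymplecticLie_positiveRoot hY) P.1 P.2⟩) ⟨?_, ?_⟩
      · rw [Module.End.mem_eigenspace_iff]
        apply Subtype.ext
        refine Eq.trans ?_ h1
        rw [dL_eq_dLDerivation (regularElement n)]
        rfl
      · exact fun h => hne (congrArg Subtype.val h)
    have h3 := hmax _ h2
    rw [Complex.add_re] at h3
    linarith
  obtain ⟨γ, hγ, t, ht⟩ := hs.exists_eq_hwPoly hn hP0 hPH.2.2
  have ht0 : t ≠ 0 := fun h => hP0 (by rw [ht, h, zero_smul])
  refine ⟨γ, hγ, ?_⟩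
  have h4 := W.smul_mem t⁻¹ P.2
  rwa [ht, smul_smul, inv_mul_cancel₀ ht0, one_smul] at h4

/-! ### Irreducibility and the direct sum decomposition -/

/-- The composition of the lowering and raising operators. -/
noncomputable def lowerRaise (n : ℕ) : Module.End ℂ (Poly n) :=
  (lower n).toLinearMap ∘ₗ (raise n).toLinearMap

/-- The eigenvalue of `lowerRaise` on the component with index `γ`. -/
def componentEigenvalue (α β γ : ℕ) : ℂ := (((α - γ) * (β - γ + 1) : ℕ) : ℂ)

theorem componentEigenvalue_injOn (α β : ℕ) :
    Set.InjOn (componentEigenvalue α β) {γ | γ ≤ min α β} := by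
  have key : ∀ γ δ, γ ≤ min α β → δ ≤ min α β → γ < δ →
      componentEigenvalue α β γ ≠ componentEigenvalue α β δ := by
    intro γ δ hγ hδ hlt h
    have h1 : (α - γ) * (β - γ + 1) = (α - δ) * (β - δ + 1) := Nat.cast_injective h
    -- The first factor decreases strictly and the second, positive one does not increase.
    have h2 : (α - δ) * (β - δ + 1) < (α - γ) * (β - γ + 1) :=
      Nat.mul_lt_mul_of_lt_of_le (by omega) (by omega) (by omega)
    omega
  intro γ hγ δ hδ h
  rcases lt_trichotomy γ δ with hlt | heq | hlt
  · exact absurd h (key γ δ hγ hδ hlt)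
  · exact heq
  · exact absurd h.symm (key δ γ hδ hγ hlt)

/-- The operator commutes with Sp(n), so its eigenspace is invariant, and it contains the generator
P_γ. -/
theorem V_le_eigenspace (hn : 2 ≤ n) {α β γ : ℕ} (hγ : γ ≤ min α β) :
    (V hn α β γ).toSubmodule ≤ (lowerRaise n).eigenspace (componentEigenvalue α β γ) := by
  refine V_le hn (fun u P hP => ?_) ?_
  · rw [Module.End.mem_eigenspace_iff] at hP ⊢
    change lower n (raise n (leftAction n u P)) = _
    rw [raise_leftAction, lower_leftAction, ← map_smul]
    exact congrArg _ hP
  · rw [Module.End.mem_eigenspace_iff]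
    exact lower_raise_hwPoly hn (by omega) (by omega)

theorem V_invariant (hn : 2 ≤ n) {α β γ : ℕ} (u : Sp n) (P : Poly n)
    (hP : P ∈ (V hn α β γ).toSubmodule) : leftAction n u P ∈ (V hn α β γ).toSubmodule :=
  (V hn α β γ).apply_mem_toSubmodule u hP

theorem V_isIrreducible (hn : 2 ≤ n) {α β γ : ℕ} (hγ : γ ≤ min α β) :
    (V hn α β γ).toRepresentation.IsIrreducible where
  exists_pair_ne := by
    refine ⟨⊥, ⊤, fun h => ?_⟩
    have h1 := congrArg Subrepresentation.toSubmodule h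
    have h2 : (⟨_, hwPoly_mem_V hn α β γ⟩ : (V hn α β γ).toSubmodule) ∈
        (⊥ : Submodule ℂ (V hn α β γ).toSubmodule) := by
      change _ ∈ (⊥ : Subrepresentation (V hn α β γ).toRepresentation).toSubmodule
      rw [h1]
      trivial
    exact hwPoly_ne_zero hn α β γ (congrArg Subtype.val ((Submodule.mem_bot ℂ).mp h2))
  eq_bot_or_eq_top σ := by
    by_cases hσ : σ.toSubmodule = ⊥
    · exact Or.inl (Subrepresentation.toSubmodule_injective hσ)
    refine Or.inr (Subrepresentation.toSubmodule_injective ?_)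
    let W : Submodule ℂ (Poly n) := σ.toSubmodule.map (V hn α β γ).toSubmodule.subtype
    have hW : ∀ u : Sp n, ∀ P ∈ W, leftAction n u P ∈ W := by
      rintro u _ ⟨P, hP, rfl⟩
      exact ⟨_, σ.apply_mem_toSubmodule u hP, rfl⟩
    have hWV : W ≤ (V hn α β γ).toSubmodule := Submodule.map_subtype_le _ _
    have hW0 : W ≠ ⊥ := fun h => hσ (Submodule.map_injective_of_injective
      (Submodule.subtype_injective _) (h.trans (Submodule.map_bot _).symm))
    obtain ⟨δ, hδ, hmem⟩ := exists_hwPoly_mem hn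
      (hWV.trans (V_le_harmonic hn (hγ.trans (min_le_left _ _)) (hγ.trans (min_le_right _ _))))
      hW0 fun Y hY P hP => dL_mem_of_leftAction hW hY.isSkewForJ hP
    -- P_δ lies in both V_γ and V_δ; as the eigenvalues are distinct, δ = γ, and the generator of
    -- V_γ lies in W.
    have e1 := Module.End.mem_eigenspace_iff.mp (V_le_eigenspace hn hγ (hWV hmem))
    have e2 := Module.End.mem_eigenspace_iff.mp (V_le_eigenspace hn hδ (hwPoly_mem_V hn α β δ))
    have e3 := smul_left_injective ℂ (hwPoly_ne_zero hn α β δ) (e1.symm.trans e2)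
    rw [← componentEigenvalue_injOn α β hγ hδ e3] at hmem
    have hVW := V_le hn hW hmem
    change σ.toSubmodule = ⊤
    rw [eq_top_iff]
    rintro ⟨P, hP⟩ -
    obtain ⟨Q, hQ, hQP⟩ := hVW hP
    have : Q = ⟨P, hP⟩ := Subtype.ext hQP
    rwa [← this]

theorem iSup_V_eq (hn : 2 ≤ n) (α β : ℕ) :
    ⨆ γ : Fin (min α β + 1), (V hn α β γ).toSubmodule = harmonic n α β := by
  have hle : ⨆ γ : Fin (min α β + 1), (V hn α β γ).toSubmodule ≤ harmonic n α β :=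
    iSup_le fun γ => V_le_harmonic hn (by omega) (by omega)
  by_contra hne
  obtain ⟨Q, hQ, hQ0, hQo⟩ := exists_fischer_orthogonal (lt_of_le_of_ne hle hne)
  set S := ⨆ γ : Fin (min α β + 1), (V hn α β γ).toSubmodule with hS
  have hSinv : ∀ u : Sp n, ∀ P ∈ S, leftAction n u P ∈ S := by
    intro u P hP
    refine Submodule.iSup_induction _ (motive := fun P => leftAction n u P ∈ S) hP
      (fun γ P hP => ?_) (by simp) fun P P' h h' => by rw [map_add]; exact add_mem h h'
    exact Submodule.mem_iSup_of_mem γ (V_invariant hn u P hP)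
  -- The orthogonal complement of the sum inside the harmonic space. It is stable under `dL Y`
  -- because the sum is stable under `dL Yᴴ`, which is again symplectic.
  let W : Submodule ℂ (Poly n) :=
    { carrier := {P | P ∈ harmonic n α β ∧ ∀ R ∈ S, fischer R P = 0}
      add_mem' := fun {P P'} h h' => ⟨add_mem h.1 h'.1, fun R hR => by
        rw [fischer_add_right, h.2 R hR, h'.2 R hR, add_zero]⟩
      zero_mem' := ⟨zero_mem _, fun R _ => fischer_zero_right R⟩
      smul_mem' := fun c P h => ⟨Submodule.smul_mem _ c h.1, fun R hR => by
        rw [fischer_smul_right, h.2 R hR, mul_zero]⟩ }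
  obtain ⟨γ, hγ, hmem⟩ := exists_hwPoly_mem hn (W := W) (α := α) (β := β) (fun P hP => hP.1)
    (fun h => hQ0 ((Submodule.mem_bot ℂ).mp (h ▸ (⟨hQ, hQo⟩ : Q ∈ W))))
    fun Y hY P hP => ⟨dL_mem_of_leftAction (fun u R => leftAction_mem_harmonic u)
      hY.isSkewForJ hP.1, fun R hR => by
        rw [← Matrix.conjTranspose_conjTranspose Y, ← fischer_dL]
        exact hP.2 _ (dL_mem_of_leftAction hSinv hY.isSkewForJ.conjTranspose hR)⟩
  have hmemS : hwPoly hn α β γ ∈ S :=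
    Submodule.mem_iSup_of_mem (⟨γ, by omega⟩ : Fin (min α β + 1)) (hwPoly_mem_V hn α β γ)
  exact hwPoly_ne_zero hn α β γ (eq_zero_of_fischer_self (hmem.2 _ hmemS))

theorem iSupIndep_V (hn : 2 ≤ n) (α β : ℕ) :
    iSupIndep fun γ : Fin (min α β + 1) => (V hn α β γ).toSubmodule := by
  have h1 := (Module.End.eigenspaces_iSupIndep (lowerRaise n)).comp
    (f := fun γ : Fin (min α β + 1) => componentEigenvalue α β γ) fun γ δ h =>
      Fin.ext (componentEigenvalue_injOn α β (Nat.lt_succ_iff.mp γ.2) (Nat.lt_succ_iff.mp δ.2) h)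
  exact h1.mono fun γ => V_le_eigenspace hn (Nat.lt_succ_iff.mp γ.2)

theorem isInternal_V (hn : 2 ≤ n) (α β : ℕ) :
    DirectSum.IsInternal (fun γ : Fin (min α β + 1) =>
      (V hn α β γ).toSubmodule.submoduleOf (harmonic n α β)) := by
  have hmap : ∀ γ : Fin (min α β + 1), ((V hn α β γ).toSubmodule.submoduleOf
      (harmonic n α β)).map (harmonic n α β).subtype = (V hn α β γ).toSubmodule := fun γ => by
    rw [Submodule.submoduleOf, Submodule.map_comap_subtype]
    exact inf_eq_right.mpr (V_le_harmonic hn (by omega) (by omega))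
  rw [DirectSum.isInternal_submodule_iff_iSupIndep_and_iSup_eq_top]
  constructor
  · intro γ
    rw [Submodule.disjoint_def]
    intro P hP hP'
    apply Subtype.ext
    refine (Submodule.disjoint_def.mp (iSupIndep_V hn α β γ)) P.1 hP ?_
    have h := Submodule.mem_map_of_mem (f := (harmonic n α β).subtype) hP'
    simp only [Submodule.map_iSup, hmap] at h
    exact h
  · apply Submodule.map_injective_of_injective (harmonic n α β).subtype_injective
    rw [Submodule.map_iSup, Submodule.map_subtype_top]
    exact (iSup_congr hmap).trans (iSup_V_eq hn α β)

/-! ### Dimension of the components -/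

theorem finiteDimensional_V (hn : 2 ≤ n) {α β γ : ℕ} (hα : γ ≤ α) (hβ : γ ≤ β) :
    FiniteDimensional ℂ (V hn α β γ).toSubmodule :=
  Submodule.finiteDimensional_of_le (V_le_harmonic hn hα hβ)

/-- The image of an invariant subspace under `raise` is invariant, and it contains the generator
because the factor a + 1 is invertible. -/
theorem V_le_map_raise (hn : 2 ≤ n) (a b γ : ℕ) : (V hn (a + γ) (b + 1 + γ) γ).toSubmodule ≤
    (V hn (a + 1 + γ) (b + γ) γ).toSubmodule.map (raise n).toLinearMap := by
  refine V_le hn ?_ ?_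
  · rintro u _ ⟨P, hP, rfl⟩
    exact ⟨_, V_invariant hn u P hP, raise_leftAction u P⟩
  · have ha : (a : ℂ) + 1 ≠ 0 := by exact_mod_cast a.succ_ne_zero
    refine ⟨((a : ℂ) + 1)⁻¹ • hwPoly hn (a + 1 + γ) (b + γ) γ,
      Submodule.smul_mem _ _ (hwPoly_mem_V hn _ _ _), ?_⟩
    rw [map_smul, Derivation.coeFn_coe, raise_hwPoly, smul_smul, inv_mul_cancel₀ ha, one_smul]

theorem V_le_map_lower (hn : 2 ≤ n) (a b γ : ℕ) : (V hn (a + 1 + γ) (b + γ) γ).toSubmodule ≤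
    (V hn (a + γ) (b + 1 + γ) γ).toSubmodule.map (lower n).toLinearMap := by
  refine V_le hn ?_ ?_
  · rintro u _ ⟨P, hP, rfl⟩
    exact ⟨_, V_invariant hn u P hP, lower_leftAction u P⟩
  · have hb : (b : ℂ) + 1 ≠ 0 := by exact_mod_cast b.succ_ne_zero
    refine ⟨((b : ℂ) + 1)⁻¹ • hwPoly hn (a + γ) (b + 1 + γ) γ,
      Submodule.smul_mem _ _ (hwPoly_mem_V hn _ _ _), ?_⟩
    rw [map_smul, Derivation.coeFn_coe, lower_hwPoly, smul_smul, inv_mul_cancel₀ hb, one_smul]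

theorem finrank_V_succ (hn : 2 ≤ n) (a b γ : ℕ) :
    Module.finrank ℂ (V hn (a + γ) (b + 1 + γ) γ).toSubmodule
      = Module.finrank ℂ (V hn (a + 1 + γ) (b + γ) γ).toSubmodule := by
  have := finiteDimensional_V hn (Nat.le_add_left γ a) (Nat.le_add_left γ (b + 1))
  have := finiteDimensional_V hn (Nat.le_add_left γ (a + 1)) (Nat.le_add_left γ b)
  exact le_antisymm
    ((Submodule.finrank_mono (V_le_map_raise hn a b γ)).trans (Submodule.finrank_map_le _ _))
    ((Submodule.finrank_mono (V_le_map_lower hn a b γ)).trans (Submodule.finrank_map_le _ _))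

theorem finrank_V_shift (hn : 2 ≤ n) (a b γ : ℕ) :
    Module.finrank ℂ (V hn (a + γ) (b + γ) γ).toSubmodule
      = Module.finrank ℂ (V hn (a + b + γ) γ γ).toSubmodule := by
  induction b generalizing a with
  | zero => rw [Nat.zero_add, Nat.add_zero]
  | succ b ih => rw [finrank_V_succ, ih, add_right_comm a 1 b, add_assoc a b 1]

/-- The dimension of a component depends only on the total degree. -/
theorem finrank_V_eq_of_add_eq (hn : 2 ≤ n) {α β α' β' γ : ℕ} (h : α + β = α' + β')
    (hγ : γ ≤ min α β) (hγ' : γ ≤ min α' β') :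
    Module.finrank ℂ (V hn α β γ).toSubmodule = Module.finrank ℂ (V hn α' β' γ).toSubmodule := by
  obtain ⟨a, rfl⟩ := Nat.exists_eq_add_of_le' (hγ.trans (min_le_left _ _))
  obtain ⟨b, rfl⟩ := Nat.exists_eq_add_of_le' (hγ.trans (min_le_right _ _))
  obtain ⟨a', rfl⟩ := Nat.exists_eq_add_of_le' (hγ'.trans (min_le_left _ _))
  obtain ⟨b', rfl⟩ := Nat.exists_eq_add_of_le' (hγ'.trans (min_le_right _ _))
  rw [finrank_V_shift, finrank_V_shift, show a + b = a' + b' by omega]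

theorem finrank_eq_sum_of_isInternal {K M ι : Type*} [Field K] [AddCommGroup M] [Module K M]
    [FiniteDimensional K M] [Fintype ι] [DecidableEq ι] {A : ι → Submodule K M}
    (h : DirectSum.IsInternal A) : Module.finrank K M = ∑ i, Module.finrank K (A i) := by
  rw [← Module.finrank_directSum]
  exact (LinearEquiv.ofBijective (DirectSum.coeLinearMap A) h).finrank_eq.symm

theorem finrank_harmonic_eq_sum (hn : 2 ≤ n) (α β : ℕ) : Module.finrank ℂ (harmonic n α β)
    = ∑ γ ∈ Finset.range (min α β + 1), Module.finrank ℂ (V hn α β γ).toSubmodule := by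
  rw [finrank_eq_sum_of_isInternal (isInternal_V hn α β), Finset.sum_range]
  refine Finset.sum_congr rfl fun γ _ => ?_
  exact (Submodule.submoduleOfEquivOfLe (V_le_harmonic hn (by omega) (by omega))).finrank_eq

theorem finrank_V_zero (hn : 2 ≤ n) (q : ℕ) :
    Module.finrank ℂ (V hn q 0 0).toSubmodule = monomialCount n q * monomialCount n 0 := by
  have h := finrank_harmonic_eq_sum hn q 0
  rw [finrank_harmonic_zero] at h
  simpa using h.symm

/-- Bidegrees (q, g+1) and (q+1, g) have the same total degree, so components with equal γ have
equal dimension. The first has exactly one more component, γ = g + 1. -/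
theorem finrank_V_add (hn : 2 ≤ n) {q g : ℕ} (h : g + 1 ≤ q) :
    Module.finrank ℂ (V hn q (g + 1) (g + 1)).toSubmodule
      + Module.finrank ℂ (harmonic n (q + 1) g) = Module.finrank ℂ (harmonic n q (g + 1)) := by
  rw [finrank_harmonic_eq_sum hn, finrank_harmonic_eq_sum hn, min_eq_right h,
    min_eq_right (by omega : g ≤ q + 1), Finset.sum_range_succ _ (g + 1), add_comm]
  refine congrArg (· + _) (Finset.sum_congr rfl fun γ hγ => ?_)
  rw [Finset.mem_range] at hγ
  exact finrank_V_eq_of_add_eq hn (by omega) (by omega) (by omega)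

theorem cast_monomialCount (M a : ℕ) {n : ℕ} (hM : 2 * n = M + 3) :
    (monomialCount n a : ℚ) = (a + M + 2).factorial / (a.factorial * (M + 2).factorial) := by
  rw [monomialCount, show 2 * n + a - 1 = a + (M + 2) by omega, Nat.cast_add_choose, add_assoc]

theorem finrank_V_self (hn : 2 ≤ n) {q g M : ℕ} (hM : 2 * n = M + 3) (h : g ≤ q) :
    (Module.finrank ℂ (V hn q g g).toSubmodule : ℚ)
      = ((q + M + 1).factorial * (g + M).factorial * ((q : ℚ) - g + 1) * (q + g + M + 2))
        / ((q + 1).factorial * g.factorial * (M + 2).factorial * M.factorial) := by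
  have hf : ∀ m : ℕ, (m.factorial : ℚ) ≠ 0 := fun m => by exact_mod_cast m.factorial_ne_zero
  rcases g with _ | g
  · rw [finrank_V_zero, Nat.cast_mul, cast_monomialCount M q hM, cast_monomialCount M 0 hM]
    have := hf M
    have := hf q
    have := hf (q + M + 1)
    rw [show q + M + 2 = q + M + 1 + 1 by rfl]
    simp only [Nat.factorial_succ, zero_add, Nat.factorial_zero]
    push_cast
    field_simp
    ring
  obtain ⟨Q, rfl⟩ := Nat.exists_eq_add_of_le' (show 1 ≤ q by omega)
  have h1 := finrank_V_add hn h
  have h2 := finrank_harmonic_succ hn Q g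
  -- For second degree 0 every polynomial is harmonic and no product is subtracted, so this case is
  -- separate.
  rcases g with _ | G
  · rw [finrank_harmonic_zero] at h1
    have h3 : (Module.finrank ℂ (V hn (Q + 1) (0 + 1) (0 + 1)).toSubmodule : ℚ)
        = monomialCount n (Q + 1) * monomialCount n (0 + 1) - monomialCount n Q * monomialCount n 0
          - monomialCount n (Q + 1 + 1) * monomialCount n 0 := by
      have h1' := congrArg (Nat.cast (R := ℚ)) h1
      have h2' := congrArg (Nat.cast (R := ℚ)) h2
      push_cast at h1' h2' ⊢
      linarith
    rw [h3]
    simp only [cast_monomialCount M _ hM]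
    have := hf M
    have := hf Q
    have := hf (Q + M)
    -- Arguments become iterated successors, so that every factorial reduces to Q!, M! or (Q + M)!
    -- and the rest is a rational identity.
    rw [show Q + 1 + 1 + M + 2 = Q + M + 1 + 1 + 1 + 1 by ring,
      show Q + 1 + M + 2 = Q + M + 1 + 1 + 1 by ring, show Q + M + 2 = Q + M + 1 + 1 by ring,
      show 0 + 1 + M + 2 = M + 1 + 1 + 1 by ring, show 0 + M + 2 = M + 1 + 1 by ring,
      show Q + 1 + M + 1 = Q + M + 1 + 1 by ring, show 0 + 1 + M = M + 1 by ring]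
    simp only [Nat.factorial_succ, zero_add, Nat.factorial_zero]
    push_cast
    field_simp
    ring
  · have h4 := finrank_harmonic_succ hn (Q + 1) G
    have h3 : (Module.finrank ℂ (V hn (Q + 1) (G + 1 + 1) (G + 1 + 1)).toSubmodule : ℚ)
        = monomialCount n (Q + 1) * monomialCount n (G + 1 + 1)
          - monomialCount n Q * monomialCount n (G + 1)
          - (monomialCount n (Q + 1 + 1) * monomialCount n (G + 1)
            - monomialCount n (Q + 1) * monomialCount n G) := by
      have h1' := congrArg (Nat.cast (R := ℚ)) h1
      have h2' := congrArg (Nat.cast (R := ℚ)) h2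
      have h4' := congrArg (Nat.cast (R := ℚ)) h4
      push_cast at h1' h2' h4' ⊢
      linarith
    rw [h3]
    simp only [cast_monomialCount M _ hM]
    have := hf M
    have := hf Q
    have := hf G
    have := hf (Q + M)
    have := hf (G + M)
    rw [show Q + 1 + 1 + M + 2 = Q + M + 1 + 1 + 1 + 1 by ring,
      show Q + 1 + M + 2 = Q + M + 1 + 1 + 1 by ring, show Q + M + 2 = Q + M + 1 + 1 by ring,
      show G + 1 + 1 + M + 2 = G + M + 1 + 1 + 1 + 1 by ring,
      show G + 1 + M + 2 = G + M + 1 + 1 + 1 by ring, show G + M + 2 = G + M + 1 + 1 by ring,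
      show Q + 1 + M + 1 = Q + M + 1 + 1 by ring, show G + 1 + 1 + M = G + M + 1 + 1 by ring]
    simp only [Nat.factorial_succ]
    push_cast
    field_simp
    ring

theorem finrank_V (hn : 2 ≤ n) {k α β γ : ℕ} (hk : k = α + β) (hγ : γ ≤ min α β) :
    (Module.finrank ℂ (V hn α β γ).toSubmodule : ℚ) =
      (Nat.factorial (k - γ + 2 * n - 2) * Nat.factorial (γ + 2 * n - 3) *
          ((k : ℚ) - 2 * γ + 1) * ((k : ℚ) + 2 * n - 1)) /
        (Nat.factorial (k - γ + 1) * Nat.factorial γ * Nat.factorial (2 * n - 1) *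
          Nat.factorial (2 * n - 3)) := by
  -- M = 2n - 3 is the smallest argument in the formula, so it removes the truncated subtractions in
  -- n.
  obtain ⟨M, hM⟩ := Nat.exists_eq_add_of_le' (show 3 ≤ 2 * n by omega)
  have hMq : (2 : ℚ) * n = M + 3 := by exact_mod_cast hM
  have hq : ((k - γ : ℕ) : ℚ) = k - γ := Nat.cast_sub (by omega)
  rw [finrank_V_eq_of_add_eq hn (α' := k - γ) (β' := γ) (by omega) hγ (by omega),
    finrank_V_self hn hM (by omega), hq, hMq, hM,
    show k - γ + (M + 3) - 2 = k - γ + M + 1 by omega, show γ + (M + 3) - 3 = γ + M by omega,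
    show M + 3 - 1 = M + 2 by omega, show M + 3 - 3 = M by omega]
  congr 1
  ring

end SpHarm

theorem proposition2 (n : ℕ) (hn : 2 ≤ n) (k α β : ℕ) (hk : k = α + β) :
    (∀ u : SpHarm.Sp n, ∀ P ∈ SpHarm.harmonic n α β,
      SpHarm.leftAction n u P ∈ SpHarm.harmonic n α β) ∧
    (∀ γ : ℕ, γ ≤ min α β →
      SpHarm.hwPoly hn α β γ ∈ SpHarm.harmonic n α β ∧
      SpHarm.IsHighestWeightVector
        (((k : ℂ) - (γ : ℂ)) • SpHarm.L (⟨0, by omega⟩ : Fin n)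
          + (γ : ℂ) • SpHarm.L (⟨1, by omega⟩ : Fin n))
        (SpHarm.hwPoly hn α β γ) ∧
      (SpHarm.V hn α β γ).toSubmodule ≤ SpHarm.harmonic n α β ∧
      (SpHarm.V hn α β γ).toRepresentation.IsIrreducible ∧
      (Module.finrank ℂ (SpHarm.V hn α β γ).toSubmodule : ℚ) =
        (Nat.factorial (k - γ + 2 * n - 2) * Nat.factorial (γ + 2 * n - 3) *
            ((k : ℚ) - 2 * γ + 1) * ((k : ℚ) + 2 * n - 1)) /
          (Nat.factorial (k - γ + 1) * Nat.factorial γ * Nat.factorial (2 * n - 1) *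
            Nat.factorial (2 * n - 3))) ∧
    DirectSum.IsInternal (fun γ : Fin (min α β + 1) =>
      (SpHarm.V hn α β γ).toSubmodule.submoduleOf (SpHarm.harmonic n α β)) := by
  refine ⟨fun u P hP => SpHarm.leftAction_mem_harmonic u hP, fun γ hγ => ?_,
    SpHarm.isInternal_V hn α β⟩
  have hα : γ ≤ α := hγ.trans (min_le_left _ _)
  have hβ : γ ≤ β := hγ.trans (min_le_right _ _)
  exact ⟨SpHarm.hwPoly_mem_harmonic hn hα hβ, SpHarm.isHighestWeightVector_hwPoly hn hk hα hβ,
    SpHarm.V_le_harmonic hn hα hβ, SpHarm.V_isIrreducible hn hγ, SpHarm.finrank_V hn hk hγ⟩
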